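/- Let $(\tilde M,J,g)$ be a locally conformal Kähler manifold with Lee form $\alpha$, normalized as follows: $(\tilde M,J)$ is a complex manifold, $g$ is a Hermitian metric, and $\tilde M$ is covered by open sets $U$ carrying smooth functions $\rho:U\to\mathbb R$ such that $e^{-2\rho}g$ is a Kähler metric on $U$ and $\alpha=d\rho$ on $U$ (so $d\alpha=0$ and $d\Omega=2\alpha\wedge\Omega$, where $\Omega(X,Y)=g(X,JY)$). Let $\lambda=\alpha^{\#}$ be the Lee vector field, $g(\lambda,X)=\alpha(X)$. Let $N^T$ and $N^\theta$ be Riemannian manifolds with metrics $g_T$ and $g_\theta$, let $f:N^T\to(0,\infty)$ be smooth, and let the warped product $M=N^T\times_f N^\theta$ (the product manifold with the metric $g_T+f^2g_\theta$) be isometrically immersed in $\tilde M$; denote the induced metric on $M$ also by $g$, and write $\ln f$ for its pull-back to $M$. Let $\mathfrak D$ and $\mathfrak D^\theta$ be the distributions on $M$ tangent to the factors $N^T$ and $N^\theta$. For $X$ tangent to $M$ write $JX=PX+FX$ with $PX$ tangent and $FX$ normal to $M$, and let $h$ be the second fundamental form of $M$ in $\tilde M$. Assume that * $\mathfrak D$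 is holomorphic: $J\mathfrak D=\mathfrak D$; * $\mathfrak D^\theta$ is proper pointwise slant: there is a function $\theta:M\to(0,\pi/2)$ such that at each point $p\in M$ the angle between $JZ$ and $\mathfrak D^\theta_p$ is $\theta(p)$ for every nonzero $Z\in\mathfrak D^\theta_p$; * the Lee vector field $\lambda$ is tangent to $M$ along $M$. Then for all vector fields $X,Y\in\Gamma(\mathfrak D)$ and $Z,W\in\Gamma(\mathfrak D^\theta)$: (i) $g(h(X,Y),FZ)=0$; (ii) $g(h(X,Z),FW)=\big[g(\lambda,JX)-JX(\ln f)\big]\,g(Z,W)+\big[g(\lambda,X)-X(\ln f)\big]\,g(Z,PW)$. -/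

import Mathlib

open Bundle
open scoped Manifold ContDiff InnerProductSpace

noncomputable section

namespace LCK

/-! ## Complex structures, the Levi-Civita connection, Kaehler and LCK metrics -/

section Ambient

/- `M` is a smooth manifold modelled, as a real manifold, on the complex vector space `E`. -/
variable {E : Type*} [NormedAddCommGroup E] [NormedSpace ℂ E]
  {M : Type*} [TopologicalSpace M] [ChartedSpace E M] [IsManifold 𝓘(ℝ, E) ∞ M]

/-- The vector field `X` is differentiable at `x`. -/
def DiffAt (X : Π x : M, TangentSpace 𝓘(ℝ, E) x) (x : M) : Prop :=
  MDifferentiableAt 𝓘(ℝ, E) 𝓘(ℝ, E).tangent (fun y => (⟨y, X y⟩ : TangentBundle 𝓘(ℝ, E) M)) x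

variable (E M) in
/-- A complex manifold `(M, J)`: a smooth field `J` of endomorphisms of the tangent bundle of the
real manifold `M` with `J² = -1`, such that around every point there is a smooth chart with values
in the complex vector space `E` whose differential intertwines `J` with multiplication by `i`
(a holomorphic chart). -/
structure ComplexStructure where
  /-- The endomorphism `J` of each tangent space. -/
  J : Π x : M, TangentSpace 𝓘(ℝ, E) x →L[ℝ] TangentSpace 𝓘(ℝ, E) x
  smooth : ContMDiff 𝓘(ℝ, E) (𝓘(ℝ, E).prod 𝓘(ℝ, E →L[ℝ] E)) ∞
    (fun x : M => TotalSpace.mk' (E →L[ℝ] E)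
      (E := fun x : M => TangentSpace 𝓘(ℝ, E) x →L[ℝ] TangentSpace 𝓘(ℝ, E) x) x (J x))
  sq : ∀ (x : M) (v : TangentSpace 𝓘(ℝ, E) x), J x (J x v) = -v
  holomorphic_charts : ∀ x : M, ∃ e ∈ IsManifold.maximalAtlas 𝓘(ℝ, E) ∞ M, x ∈ e.source ∧
    ∀ y ∈ e.source, ∀ v : TangentSpace 𝓘(ℝ, E) y,
      mvfderiv 𝓘(ℝ, E) e y (J y v) = Complex.I • mvfderiv 𝓘(ℝ, E) e y v

/-- `nabla` (with `nabla Y x u` standing for `(∇_u Y)(x)`) is, on the set `U`, the Levi-Civita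
connection of the field `G` of inner products: it is a covariant derivative on the tangent bundle
which is torsion free and for which `G` is parallel. -/
structure IsLeviCivitaOn
    (G : Π x : M, TangentSpace 𝓘(ℝ, E) x →L[ℝ] TangentSpace 𝓘(ℝ, E) x →L[ℝ] ℝ) (U : Set M)
    (nabla : (Π x : M, TangentSpace 𝓘(ℝ, E) x) →
      (Π x : M, TangentSpace 𝓘(ℝ, E) x →L[ℝ] TangentSpace 𝓘(ℝ, E) x)) : Prop where
  isCovariantDerivativeOn : IsCovariantDerivativeOn E nabla U
  torsion_free : ∀ x ∈ U, ∀ X Y : Π x : M, TangentSpace 𝓘(ℝ, E) x,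
    DiffAt X x → DiffAt Y x →
      nabla Y x (X x) - nabla X x (Y x) = VectorField.mlieBracket 𝓘(ℝ, E) X Y x
  metric : ∀ x ∈ U, ∀ Y Z : Π x : M, TangentSpace 𝓘(ℝ, E) x,
    DiffAt Y x → DiffAt Z x → ∀ u : TangentSpace 𝓘(ℝ, E) x,
      mvfderiv 𝓘(ℝ, E) (fun y => G y (Y y) (Z y)) x u
        = G x (nabla Y x u) (Z x) + G x (Y x) (nabla Z x u)

/-- The field `G` of inner products is a Kaehler metric on the open set `U` for the complex
structure `J`: it is Hermitian, and `J` is parallel for its Levi-Civita connection. -/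
def IsKaehlerOn (C : ComplexStructure E M)
    (G : Π x : M, TangentSpace 𝓘(ℝ, E) x →L[ℝ] TangentSpace 𝓘(ℝ, E) x →L[ℝ] ℝ)
    (U : Set M) : Prop :=
  (∀ x ∈ U, ∀ u v : TangentSpace 𝓘(ℝ, E) x, G x (C.J x u) (C.J x v) = G x u v) ∧
  ∃ nabla : (Π x : M, TangentSpace 𝓘(ℝ, E) x) →
      (Π x : M, TangentSpace 𝓘(ℝ, E) x →L[ℝ] TangentSpace 𝓘(ℝ, E) x),
    IsLeviCivitaOn G U nabla ∧
    ∀ x ∈ U, ∀ Y : Π x : M, TangentSpace 𝓘(ℝ, E) x, DiffAt Y x →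
      ∀ u : TangentSpace 𝓘(ℝ, E) x,
        nabla (fun y => C.J y (Y y)) x u = C.J x (nabla Y x u)

/- From here on `M` carries a Riemannian metric `g`, written `⟪·, ·⟫_ℝ`. -/
variable [RiemannianBundle (fun x : M => TangentSpace 𝓘(ℝ, E) x)]

variable (E M) in
/-- The Riemannian metric of `M` as a field of bilinear forms. -/
def metric (x : M) : TangentSpace 𝓘(ℝ, E) x →L[ℝ] TangentSpace 𝓘(ℝ, E) x →L[ℝ] ℝ :=
  innerSL ℝ

/-- The conformally changed metric `exp (-2 ρ) g`. -/
def conformalMetric (ρ : M → ℝ) (x : M) :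
    TangentSpace 𝓘(ℝ, E) x →L[ℝ] TangentSpace 𝓘(ℝ, E) x →L[ℝ] ℝ :=
  Real.exp (-2 * ρ x) • metric E M x

/-- `(M, J, g)` is a locally conformal Kaehler manifold with Lee form `α`: the metric `g` is
Hermitian, and `M` is covered by open sets `U` with smooth functions `ρ : U → ℝ` such that
`exp (-2 ρ) g` is a Kaehler metric on `U` and `α = dρ` on `U`. -/
structure IsLCK (C : ComplexStructure E M)
    (α : Π x : M, TangentSpace 𝓘(ℝ, E) x →L[ℝ] ℝ) : Prop where
  hermitian : ∀ (x : M) (u v : TangentSpace 𝓘(ℝ, E) x), ⟪C.J x u, C.J x v⟫_ℝ = ⟪u, v⟫_ℝ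
  locally_conformal : ∀ x : M, ∃ U : Set M, IsOpen U ∧ x ∈ U ∧ ∃ ρ : M → ℝ,
    ContMDiffOn 𝓘(ℝ, E) 𝓘(ℝ, ℝ) ∞ ρ U ∧ IsKaehlerOn C (conformalMetric ρ) U ∧
    ∀ y ∈ U, α y = mvfderiv 𝓘(ℝ, E) ρ y

variable [FiniteDimensional ℂ E]

instance (x : M) : FiniteDimensional ℝ (TangentSpace 𝓘(ℝ, E) x) :=
  inferInstanceAs (FiniteDimensional ℝ E)

instance (x : M) : CompleteSpace (TangentSpace 𝓘(ℝ, E) x) :=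
  FiniteDimensional.complete ℝ _

/-- The Lee vector field `λ = α^#`, dual to the Lee form: `g(λ, v) = α(v)`. -/
def leeVector (α : Π x : M, TangentSpace 𝓘(ℝ, E) x →L[ℝ] ℝ) (x : M) : TangentSpace 𝓘(ℝ, E) x :=
  (InnerProductSpace.toDual ℝ (TangentSpace 𝓘(ℝ, E) x)).symm (α x)

end Ambient

/-! ## Warped products and their immersions -/

section Warped

variable {E : Type*} [NormedAddCommGroup E] [NormedSpace ℂ E] [FiniteDimensional ℂ E]
  {M : Type*} [TopologicalSpace M] [ChartedSpace E M] [IsManifold 𝓘(ℝ, E) ∞ M]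
  [RiemannianBundle (fun x : M => TangentSpace 𝓘(ℝ, E) x)]
  {E₁ : Type*} [NormedAddCommGroup E₁] [NormedSpace ℝ E₁]
  {N₁ : Type*} [TopologicalSpace N₁] [ChartedSpace E₁ N₁]
  {E₂ : Type*} [NormedAddCommGroup E₂] [NormedSpace ℝ E₂]
  {N₂ : Type*} [TopologicalSpace N₂] [ChartedSpace E₂ N₂]

variable (E₁ E₂) in
/-- The model with corners of the product manifold `N₁ × N₂`. -/
abbrev prodModel : ModelWithCorners ℝ (E₁ × E₂) (ModelProd E₁ E₂) :=
  𝓘(ℝ, E₁).prod 𝓘(ℝ, E₂)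

variable (E₁ E₂) in
/-- The tangent space of the product manifold `N₁ × N₂`. -/
abbrev TProd (p : N₁ × N₂) : Type _ := TangentSpace (prodModel E₁ E₂) p

/-- The tangent map of the projection to the first factor. -/
abbrev dπ₁ (p : N₁ × N₂) : TProd E₁ E₂ p →L[ℝ] TangentSpace 𝓘(ℝ, E₁) p.1 :=
  mfderiv (prodModel E₁ E₂) 𝓘(ℝ, E₁) Prod.fst p

/-- The tangent map of the projection to the second factor. -/
abbrev dπ₂ (p : N₁ × N₂) : TProd E₁ E₂ p →L[ℝ] TangentSpace 𝓘(ℝ, E₂) p.2 :=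
  mfderiv (prodModel E₁ E₂) 𝓘(ℝ, E₂) Prod.snd p

variable (E₁ E₂) in
/-- The distribution `𝔇` of vectors tangent to the first factor. -/
def dist₁ (p : N₁ × N₂) : Submodule ℝ (TProd E₁ E₂ p) :=
  LinearMap.ker (dπ₂ (E₁ := E₁) (E₂ := E₂) p).toLinearMap

variable (E₁ E₂) in
/-- The distribution `𝔇^θ` of vectors tangent to the second factor. -/
def dist₂ (p : N₁ × N₂) : Submodule ℝ (TProd E₁ E₂ p) :=
  LinearMap.ker (dπ₁ (E₁ := E₁) (E₂ := E₂) p).toLinearMap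

variable (E₁ E₂) in
/-- The warped product metric `π₁^* g₁ + (f ∘ π₁)² π₂^* g₂` on `N₁ × N₂`. -/
def warped [RiemannianBundle (fun x : N₁ => TangentSpace 𝓘(ℝ, E₁) x)]
    [RiemannianBundle (fun x : N₂ => TangentSpace 𝓘(ℝ, E₂) x)] (f : N₁ → ℝ)
    (p : N₁ × N₂) (u v : TProd E₁ E₂ p) : ℝ :=
  ⟪dπ₁ p u, dπ₁ p v⟫_ℝ + f p.1 ^ 2 * ⟪dπ₂ p u, dπ₂ p v⟫_ℝ

variable (E E₁ E₂) in
/-- The differential of a map `φ : N₁ × N₂ → M`. -/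
abbrev dmap (φ : N₁ × N₂ → M) (p : N₁ × N₂) :
    TProd E₁ E₂ p →L[ℝ] TangentSpace 𝓘(ℝ, E) (φ p) :=
  mfderiv (prodModel E₁ E₂) 𝓘(ℝ, E) φ p

variable (E E₁ E₂) in
/-- The tangent space of the immersed submanifold `φ`, as a subspace of the tangent space of the
ambient manifold. -/
def tanSpace (φ : N₁ × N₂ → M) (p : N₁ × N₂) : Submodule ℝ (TangentSpace 𝓘(ℝ, E) (φ p)) :=
  LinearMap.range (dmap E E₁ E₂ φ p).toLinearMap

variable (E₁ E₂) in
/-- The normal component of an ambient vector at a point of the submanifold. -/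
def normalPart (φ : N₁ × N₂ → M) (p : N₁ × N₂) (w : TangentSpace 𝓘(ℝ, E) (φ p)) :
    TangentSpace 𝓘(ℝ, E) (φ p) :=
  (tanSpace E E₁ E₂ φ p)ᗮ.starProjection w

theorem exists_tangent (φ : N₁ × N₂ → M) (p : N₁ × N₂) (w : TangentSpace 𝓘(ℝ, E) (φ p)) :
    ∃ u : TProd E₁ E₂ p, dmap E E₁ E₂ φ p u = (tanSpace E E₁ E₂ φ p).starProjection w :=
  (tanSpace E E₁ E₂ φ p).starProjection_apply_mem w

/-- `P u`: the vector tangent to the submanifold whose image under `dφ` is the tangential component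
of `J (dφ u)`. It is unique because `φ` will be an immersion. -/
def tanJ (C : ComplexStructure E M) (φ : N₁ × N₂ → M) (p : N₁ × N₂) (u : TProd E₁ E₂ p) :
    TProd E₁ E₂ p :=
  (exists_tangent φ p (C.J (φ p) (dmap E E₁ E₂ φ p u))).choose

/-- `F u`: the normal component of `J (dφ u)`. -/
def normJ (C : ComplexStructure E M) (φ : N₁ × N₂ → M) (p : N₁ × N₂) (u : TProd E₁ E₂ p) :
    TangentSpace 𝓘(ℝ, E) (φ p) :=
  normalPart E₁ E₂ φ p (C.J (φ p) (dmap E E₁ E₂ φ p u))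

/-- The covariant derivative `∇_u V`, at `p`, of a vector field `V` along the map `φ`, induced by
the connection `nabla` of `M`. Let `t` be the local trivialization of `TM` around `φ p`, so that
`V = ∑ Vⁱ (eᵢ ∘ φ)` near `p` for the local frame `eᵢ` which is constant in `t`. Then
`∇_u V = ∑ dVⁱ(u) eᵢ + ∑ Vⁱ(p) ∇_{dφ u} eᵢ`; the first sum is the derivative of the components read
in `t`, and `FiberBundle.extend E (V p)` is the field `∑ Vⁱ(p) eᵢ` with constant components. -/
def covDerivAlong
    (nabla : (Π x : M, TangentSpace 𝓘(ℝ, E) x) →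
      (Π x : M, TangentSpace 𝓘(ℝ, E) x →L[ℝ] TangentSpace 𝓘(ℝ, E) x))
    (φ : N₁ × N₂ → M) (V : Π p : N₁ × N₂, TangentSpace 𝓘(ℝ, E) (φ p)) (p : N₁ × N₂)
    (u : TProd E₁ E₂ p) : TangentSpace 𝓘(ℝ, E) (φ p) :=
  let t := trivializationAt E (TangentSpace 𝓘(ℝ, E) : M → Type _) (φ p)
  t.symm (φ p) (mvfderiv (prodModel E₁ E₂)
      (fun q => (t (TotalSpace.mk' E (φ q) (V q))).2) p u)
    + nabla (FiberBundle.extend E (V p)) (φ p) (dmap E E₁ E₂ φ p u)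

/-- The second fundamental form `h(X, Y)`: the normal component of `∇_X Y` (Gauss formula). -/
def secondFF
    (nabla : (Π x : M, TangentSpace 𝓘(ℝ, E) x) →
      (Π x : M, TangentSpace 𝓘(ℝ, E) x →L[ℝ] TangentSpace 𝓘(ℝ, E) x))
    (φ : N₁ × N₂ → M) (X Y : Π p : N₁ × N₂, TProd E₁ E₂ p) (p : N₁ × N₂) :
    TangentSpace 𝓘(ℝ, E) (φ p) :=
  normalPart E₁ E₂ φ p (covDerivAlong nabla φ (fun q => dmap E E₁ E₂ φ q (Y q)) p (X p))

/-- `X(ln f)` at `p`, for a tangent vector `u` of `N₁ × N₂` and a function `f` on `N₁`. -/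
def derivLog (f : N₁ → ℝ) (p : N₁ × N₂) (u : TProd E₁ E₂ p) : ℝ :=
  mvfderiv (prodModel E₁ E₂) (fun q : N₁ × N₂ => Real.log (f q.1)) p u

/-- The vector field `X` on `N₁ × N₂` is smooth. -/
def SmoothField [IsManifold 𝓘(ℝ, E₁) ∞ N₁] [IsManifold 𝓘(ℝ, E₂) ∞ N₂]
    (X : Π p : N₁ × N₂, TProd E₁ E₂ p) : Prop :=
  ContMDiff (prodModel E₁ E₂) (prodModel E₁ E₂).tangent ∞
    (fun p => (⟨p, X p⟩ : TangentBundle (prodModel E₁ E₂) (N₁ × N₂)))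

/-- The distribution `D` along `φ` is proper pointwise slant with slant function `θ`: at every
point `p`, the angle between `J z` and `D p` is equal to `θ p` for every nonzero `z` in `D p`
(that is, `‖proj_D (J z)‖ = cos (θ p) ‖J z‖`), where `0 < θ p < π / 2`. -/
def IsProperPointwiseSlant (C : ComplexStructure E M) (φ : N₁ × N₂ → M)
    (D : Π p : N₁ × N₂, Submodule ℝ (TProd E₁ E₂ p)) (θ : N₁ × N₂ → ℝ) : Prop :=
  ∀ p, 0 < θ p ∧ θ p < Real.pi / 2 ∧ ∀ z ∈ D p,
    ‖((D p).map (dmap E E₁ E₂ φ p).toLinearMap).starProjection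
        (C.J (φ p) (dmap E E₁ E₂ φ p z))‖
      = Real.cos (θ p) * ‖C.J (φ p) (dmap E E₁ E₂ φ p z)‖

/-- `φ` exhibits the warped product `N₁ ×_f N₂` as a pointwise semi-slant warped product
submanifold `N^T ×_f N^θ` of `M`: `f` is smooth and positive, `φ` is a smooth isometric immersion
for the warped product metric, the distribution tangent to `N₁` is invariant under `J`, and the
distribution tangent to `N₂` is proper pointwise slant with slant function `θ`. -/
structure IsSemiSlantWarpedProduct
    [RiemannianBundle (fun x : N₁ => TangentSpace 𝓘(ℝ, E₁) x)]
    [RiemannianBundle (fun x : N₂ => TangentSpace 𝓘(ℝ, E₂) x)]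
    (C : ComplexStructure E M) (φ : N₁ × N₂ → M) (f : N₁ → ℝ) (θ : N₁ × N₂ → ℝ) : Prop where
  smooth_warping : ContMDiff 𝓘(ℝ, E₁) 𝓘(ℝ, ℝ) ∞ f
  pos_warping : ∀ x, 0 < f x
  smooth : ContMDiff (prodModel E₁ E₂) 𝓘(ℝ, E) ∞ φ
  isometric : ∀ (p : N₁ × N₂) (u v : TProd E₁ E₂ p),
    ⟪dmap E E₁ E₂ φ p u, dmap E E₁ E₂ φ p v⟫_ℝ = warped E₁ E₂ f p u v
  holomorphic : ∀ p : N₁ × N₂,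
    ((dist₁ E₁ E₂ p).map (dmap E E₁ E₂ φ p).toLinearMap).map (C.J (φ p)).toLinearMap
      = (dist₁ E₁ E₂ p).map (dmap E E₁ E₂ φ p).toLinearMap
  slant : IsProperPointwiseSlant C φ (dist₂ E₁ E₂) θ

end Warped

end LCK

end

open LCK

/-! Everything is reduced to vectors at one point p. Extend v tangent to the product to a field
constant in the chart at p, and let H(u,v) = ∇_u(dφ v) for this extension (`hessian`). Another field
with the same value at p changes ∇_u(dφ v) only by a vector tangent to the submanifold, so the
normal part of H is the second fundamental form (`secondFF_eq_hessian`). H is symmetric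
(`hessian_symm`), and its tangential part is determined by derivatives of the warped metric
(`koszul`): for vectors of 𝔇, H has no 𝔇^θ-component, and g(H(u,v),w) = v(ln f) g(u,w) for v in 𝔇
and u, w in 𝔇^θ.

The complex structure enters through ∇J. Comparing the Levi-Civita connections of g and of a local
Kähler metric e^{-2ρ}g, for which J is parallel, gives (∇_u J)Y = α(JY)u - g(u,JY)λ - α(Y)Ju +
g(u,Y)Jλ (`nabla_J`, carried over to fields along φ by `covDerivAlong_J`). Since 𝔇 is holomorphic
and orthogonal to 𝔇^θ, g(JY,Z) = 0 for Y in 𝔇 and Z in 𝔇^θ. Differentiating this relation expresses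
g(H(u,y),Jz) through g(Jy,H(u,z)) and Lee terms (`inner_hessian_J`). As Fz = Jz - Pz with Pz in 𝔇^θ,
subtracting the known tangential term gives g(h(u,y),Fz).

With u in 𝔇^θ this is (ii). With u = x in 𝔇 only -g(x,Jy)α(z) + g(x,y)g(Jλ,z) remains. The left side
is symmetric in x and y while g(x,Jy) is skew, so comparing the two orders of the pair (Jy, y)
forces |y|²α(z) = 0 (`leeForm_dist₂`). Hence α vanishes on 𝔇^θ unless 𝔇 = 0; since λ is tangent,
g(λ,Jz) = α(Pz) = 0 as well, which is (i). -/

noncomputable section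

namespace LCK

/-! ### Product rules and local components of sections along a map -/

section Bundles

variable {EN : Type*} [NormedAddCommGroup EN] [NormedSpace ℝ EN]
  {HN : Type*} [TopologicalSpace HN] {I : ModelWithCorners ℝ EN HN}
  {N : Type*} [TopologicalSpace N] [ChartedSpace HN N]
  {EB : Type*} [NormedAddCommGroup EB] [NormedSpace ℝ EB]
  {HB : Type*} [TopologicalSpace HB] {IB : ModelWithCorners ℝ EB HB}
  {B : Type*} [TopologicalSpace B] [ChartedSpace HB B]
  {F : Type*} [NormedAddCommGroup F] [NormedSpace ℝ F]
  {F' : Type*} [NormedAddCommGroup F'] [NormedSpace ℝ F']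

/-- Product rule for a map `Ψ` which is linear in its second variable. -/
theorem mvfderiv_apply_linear {Ψ : N → F → F'} {c : N → F} {p : N}
    (hΨ : MDifferentiableAt (I.prod 𝓘(ℝ, F)) 𝓘(ℝ, F') (fun z : N × F => Ψ z.1 z.2) (p, c p))
    (hc : MDifferentiableAt I 𝓘(ℝ, F) c p) (L : F →L[ℝ] F') (hL : ∀ a, Ψ p a = L a)
    (u : TangentSpace I p) :
    mvfderiv I (fun q => Ψ q (c q)) p u
      = mvfderiv I (fun q => Ψ q (c p)) p u + L (mvfderiv I c p u) := by
  have h1 : HasMFDerivAt I (I.prod 𝓘(ℝ, F)) (fun q => (q, c q)) p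
      ((ContinuousLinearMap.id ℝ (TangentSpace I p)).prod (mfderiv I 𝓘(ℝ, F) c p)) :=
    (hasMFDerivAt_id p).prodMk hc.hasMFDerivAt
  have h2 : HasMFDerivAt I (I.prod 𝓘(ℝ, F)) (fun q => (q, c p)) p
      ((ContinuousLinearMap.id ℝ (TangentSpace I p)).prod 0) :=
    (hasMFDerivAt_id p).prodMk (hasMFDerivAt_const (c p) p)
  have h3 : HasMFDerivAt 𝓘(ℝ, F) (I.prod 𝓘(ℝ, F)) (fun a : F => (p, a)) (c p)
      ((0 : F →L[ℝ] EN).prod (ContinuousLinearMap.id ℝ F)) :=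
    (hasMFDerivAt_const p (c p)).prodMk (hasMFDerivAt_id (c p))
  have k1 := (HasMFDerivAt.comp p hΨ.hasMFDerivAt h1).mfderiv
  have k2 := (HasMFDerivAt.comp p hΨ.hasMFDerivAt h2).mfderiv
  have k3 := (HasMFDerivAt.comp (c p) hΨ.hasMFDerivAt h3).mfderiv
  have k4 : mfderiv 𝓘(ℝ, F) 𝓘(ℝ, F') (fun a => Ψ p a) (c p) = L := by
    rw [show (fun a => Ψ p a) = L from funext hL, mfderiv_eq_fderiv, L.fderiv]
  have e1 := congrArg (fun A => A u) k1
  have e2 := congrArg (fun A => A u) k2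
  have e3 := congrArg (fun A => A (mfderiv I 𝓘(ℝ, F) c p u)) (k4.symm.trans k3)
  refine e1.trans ?_
  refine Eq.trans ?_ (congrArg₂ (fun a b : F' => a + b) e2 e3).symm
  refine Eq.trans ?_ (map_add (mfderiv (I.prod 𝓘(ℝ, F)) 𝓘(ℝ, F')
    (fun z : N × F => Ψ z.1 z.2) (p, c p)) _ _)
  -- The derivative of q ↦ (q, c q) splits into a part moving only the base point and a part moving
  -- only the linear variable.
  have h0 : ∀ (a : EN) (b : F), (a, b) = (a, (0 : F)) + ((0 : EN), b) := by simp
  exact congrArg (mfderiv (I.prod 𝓘(ℝ, F)) 𝓘(ℝ, F') (fun z : N × F => Ψ z.1 z.2) (p, c p))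
    (h0 u (mfderiv I 𝓘(ℝ, F) c p u))

theorem mvfderiv_congr {f g : N → F'} {p : N} (h : f =ᶠ[nhds p] g) :
    mvfderiv I f p = mvfderiv I g p := by
  ext u
  exact congrArg (fun A : EN →L[ℝ] F' => A u) h.mfderiv_eq

theorem mvfderiv_comp_real {h : ℝ → ℝ} {h' : ℝ} {g : N → ℝ} {p : N}
    (hh : HasDerivAt h h' (g p)) (hg : MDifferentiableAt I 𝓘(ℝ, ℝ) g p) (u : TangentSpace I p) :
    mvfderiv I (fun q => h (g q)) p u = h' * mvfderiv I g p u := by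
  have k := (HasMFDerivAt.comp p hh.hasFDerivAt.hasMFDerivAt hg.hasMFDerivAt).mfderiv
  refine (congrArg (fun A : EN →L[ℝ] ℝ => A u) k).trans ?_
  exact mul_comm (G := ℝ) (mfderiv I 𝓘(ℝ, ℝ) g p u) h'

set_option linter.unusedSectionVars false

variable {V : B → Type*} [TopologicalSpace (TotalSpace F V)] [∀ x, TopologicalSpace (V x)]
  [∀ x, AddCommGroup (V x)] [∀ x, Module ℝ (V x)] [FiberBundle F V] [VectorBundle ℝ F V]

/-- The components of a section along `φ` in the preferred trivialization at `φ p`. -/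
def comps (F : Type*) [NormedAddCommGroup F] [NormedSpace ℝ F]
    [TopologicalSpace (TotalSpace F V)] [FiberBundle F V]
    (φ : N → B) (s : Π q, V (φ q)) (p q : N) : F :=
  (trivializationAt F V (φ p) (TotalSpace.mk' F (φ q) (s q))).2

/-- The section along `φ` with constant components `a` in the trivialization at `φ p`. -/
def constSec (F : Type*) [NormedAddCommGroup F] [NormedSpace ℝ F]
    [TopologicalSpace (TotalSpace F V)] [FiberBundle F V]
    (φ : N → B) (p : N) (a : F) (q : N) : V (φ q) :=
  (trivializationAt F V (φ p)).symm (φ q) a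

theorem eventually_mem_baseSet {φ : N → B} {p : N} (hφ : ContinuousAt φ p) :
    ∀ᶠ q in nhds p, φ q ∈ (trivializationAt F V (φ p)).baseSet :=
  hφ.eventually ((trivializationAt F V (φ p)).open_baseSet.mem_nhds
    (FiberBundle.mem_baseSet_trivializationAt' (φ p)))

theorem constSec_comps {φ : N → B} {s : Π q, V (φ q)} {p q : N}
    (hq : φ q ∈ (trivializationAt F V (φ p)).baseSet) :
    constSec F φ p (comps F φ s p q) q = s q := by
  simp [constSec, comps, hq]

theorem comps_constSec {φ : N → B} {p q : N} {a : F}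
    (hq : φ q ∈ (trivializationAt F V (φ p)).baseSet) :
    comps F (V := V) φ (constSec F φ p a) p q = a := by
  simp [constSec, comps, hq]

theorem mdifferentiableAt_comps {φ : N → B} {s : Π q, V (φ q)} {p : N}
    (hs : MDifferentiableAt I (IB.prod 𝓘(ℝ, F)) (fun q => (⟨φ q, s q⟩ : TotalSpace F V)) p) :
    MDifferentiableAt I 𝓘(ℝ, F) (comps F φ s p) p :=
  (mdifferentiableAt_totalSpace _ _).1 hs |>.2

theorem mdifferentiableAt_constSec_prod {φ : N → B} {p : N}
    (hφ : MDifferentiableAt I IB φ p) (a : F) :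
    MDifferentiableAt (I.prod 𝓘(ℝ, F)) (IB.prod 𝓘(ℝ, F))
      (fun z : N × F => (⟨φ z.1, constSec F φ p z.2 z.1⟩ : TotalSpace F V)) (p, a) := by
  rw [mdifferentiableAt_totalSpace]
  have hfst : MDifferentiableAt (I.prod 𝓘(ℝ, F)) I (Prod.fst : N × F → N) (p, a) :=
    mdifferentiableAt_fst
  refine ⟨MDifferentiableAt.comp (g := φ) (p, a) hφ hfst, ?_⟩
  have hsnd : MDifferentiableAt (I.prod 𝓘(ℝ, F)) 𝓘(ℝ, F) (Prod.snd : N × F → F) (p, a) :=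
    mdifferentiableAt_snd
  refine hsnd.congr_of_eventuallyEq ?_
  filter_upwards [continuousAt_fst.eventually
    (eventually_mem_baseSet (F := F) (V := V) hφ.continuousAt)] with z hz
  exact comps_constSec (φ := φ) (V := V) hz

end Bundles

/-! ### Connection form and brackets of fields constant in a trivialization -/

section Ambient

set_option linter.unusedSectionVars false

variable {E : Type*} [NormedAddCommGroup E] [NormedSpace ℂ E] [FiniteDimensional ℂ E]
  {M : Type*} [TopologicalSpace M] [ChartedSpace E M] [IsManifold 𝓘(ℝ, E) ∞ M]

theorem diffAt_extend {x : M} (v : TangentSpace 𝓘(ℝ, E) x) :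
    DiffAt (FiberBundle.extend E v : Π y : M, TangentSpace 𝓘(ℝ, E) y) x :=
  FiberBundle.mdifferentiableAt_extend 𝓘(ℝ, E) E v

theorem diffAt_J (C : ComplexStructure E M) {Y : Π x : M, TangentSpace 𝓘(ℝ, E) x} {x : M}
    (hY : DiffAt Y x) : DiffAt (fun y => C.J y (Y y)) x :=
  MDifferentiableAt.clm_bundle_apply (b := fun y : M => y)
    ((C.smooth x).mdifferentiableAt (by simp)) hY

/-- The connection form: a covariant derivative is the derivative of the components plus a term
which is linear in the value of the field. -/
theorem nabla_eq_comps
    {nabla : (Π x : M, TangentSpace 𝓘(ℝ, E) x) →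
      (Π x : M, TangentSpace 𝓘(ℝ, E) x →L[ℝ] TangentSpace 𝓘(ℝ, E) x)}
    (hn : IsCovariantDerivativeOn E nabla Set.univ)
    {Y : Π x : M, TangentSpace 𝓘(ℝ, E) x} {x : M} (hY : DiffAt Y x)
    (w : TangentSpace 𝓘(ℝ, E) x) :
    nabla Y x w = (trivializationAt E (TangentSpace 𝓘(ℝ, E) : M → Type _) x).symmL ℝ x
        (mvfderiv 𝓘(ℝ, E) (comps E (fun y : M => y) Y x) x w)
      + nabla (FiberBundle.extend E (Y x)) x w := by
  have : FiniteDimensional ℝ E := FiniteDimensional.complexToReal E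
  set t := trivializationAt E (TangentSpace 𝓘(ℝ, E) : M → Type _) x with ht
  have hxt : x ∈ t.baseSet := FiberBundle.mem_baseSet_trivializationAt' x
  have hev : ∀ᶠ y in nhds x, y ∈ t.baseSet := t.open_baseSet.mem_nhds hxt
  have hlin : ∀ Z : Π x : M, TangentSpace 𝓘(ℝ, E) x, ∀ y, y ∈ t.baseSet →
      comps E (fun y : M => y) Z x y = t.continuousLinearMapAt ℝ y (Z y) := by
    intro Z y hy
    rw [Trivialization.continuousLinearMapAt_apply, Trivialization.linearMapAt_apply, if_pos hy]
    rfl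
  -- The Leibniz terms of `nabla` and of the derivative of components cancel, so the difference
  -- depends only on the value at x; it can then be evaluated on the extension with constant
  -- components, for which the derivative term is zero.
  have htens : TensorialAt 𝓘(ℝ, E) E (fun Z : Π x : M, TangentSpace 𝓘(ℝ, E) x =>
      nabla Z x w - t.symmL ℝ x (mvfderiv 𝓘(ℝ, E) (comps E (fun y : M => y) Z x) x w)) x := by
    refine ⟨fun {f σ} hf hσ => ?_, fun {σ σ'} hσ hσ' => ?_⟩
    · have e1 : comps E (fun y : M => y) (f • σ) x
          =ᶠ[nhds x] f • comps E (fun y : M => y) σ x := by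
        filter_upwards [hev] with y hy
        rw [Pi.smul_apply', hlin _ y hy, hlin _ y hy, Pi.smul_apply', map_smul]
      have e2 : mvfderiv 𝓘(ℝ, E) (comps E (fun y : M => y) (f • σ) x) x w
          = f x • mvfderiv 𝓘(ℝ, E) (comps E (fun y : M => y) σ x) x w
            + mvfderiv 𝓘(ℝ, E) f x w • comps E (fun y : M => y) σ x x := by
        rw [mvfderiv_congr e1, mvfderiv_smul hf (mdifferentiableAt_comps hσ)]
        simp
      rw [e2, hn.leibniz hσ hf, hlin _ x hxt, map_add, map_smul, map_smul,
        Trivialization.symmL_continuousLinearMapAt _ hxt]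
      simp
      module
    · have e1 : comps E (fun y : M => y) (σ + σ') x
          =ᶠ[nhds x] comps E (fun y : M => y) σ x + comps E (fun y : M => y) σ' x := by
        filter_upwards [hev] with y hy
        rw [Pi.add_apply, hlin _ y hy, hlin _ y hy, hlin _ y hy, Pi.add_apply, map_add]
      have e2 : mvfderiv 𝓘(ℝ, E) (comps E (fun y : M => y) (σ + σ') x) x w
          = mvfderiv 𝓘(ℝ, E) (comps E (fun y : M => y) σ x) x w
            + mvfderiv 𝓘(ℝ, E) (comps E (fun y : M => y) σ' x) x w := by
        rw [mvfderiv_congr e1, mvfderiv_add (mdifferentiableAt_comps hσ)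
          (mdifferentiableAt_comps hσ')]
        simp
      rw [e2, hn.add hσ hσ', map_add]
      simp
      abel
  have h0 : mvfderiv 𝓘(ℝ, E) (comps E (fun y : M => y) (FiberBundle.extend E (Y x)) x) x w = 0 := by
    have e1 : comps E (fun y : M => y) (FiberBundle.extend E (Y x)) x
        =ᶠ[nhds x] fun _ => (t ⟨x, Y x⟩).2 := by
      filter_upwards [hev] with y hy
      exact comps_constSec (V := (TangentSpace 𝓘(ℝ, E) : M → Type _)) (φ := fun y : M => y) hy
    rw [mvfderiv_congr e1, mvfderiv_const]
    rfl
  have key := htens.pointwise hY (diffAt_extend (Y x)) (by simp)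
  simp only [h0, map_zero, sub_zero] at key
  rw [← key]
  abel

/-- The trivialization of the tangent bundle at x is the one induced by the chart at x, so both
fields become constant vector fields when read in that chart, and constant fields commute. -/
theorem mlieBracket_extend {x : M} (u v : TangentSpace 𝓘(ℝ, E) x) :
    VectorField.mlieBracket 𝓘(ℝ, E) (FiberBundle.extend E u : Π y : M, TangentSpace 𝓘(ℝ, E) y)
      (FiberBundle.extend E v) x = 0 := by
  have key : ∀ u : TangentSpace 𝓘(ℝ, E) x, ∃ a : E,
      VectorField.mpullbackWithin 𝓘(ℝ, E) 𝓘(ℝ, E) (extChartAt 𝓘(ℝ, E) x).symm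
        (FiberBundle.extend E u) (Set.range 𝓘(ℝ, E))
        =ᶠ[nhds (extChartAt 𝓘(ℝ, E) x x)] fun _ => a := by
    intro u
    set t := trivializationAt E (TangentSpace 𝓘(ℝ, E) : M → Type _) x with ht
    refine ⟨(t ⟨x, u⟩).2, ?_⟩
    filter_upwards [extChartAt_target_mem_nhds (I := 𝓘(ℝ, E)) x] with y hy
    have hy' : (extChartAt 𝓘(ℝ, E) x).symm y ∈ (chartAt E x).source := by
      simpa using (extChartAt 𝓘(ℝ, E) x).map_target hy
    have hs := TangentBundle.symmL_trivializationAt (I := 𝓘(ℝ, E)) hy'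
    rw [(extChartAt 𝓘(ℝ, E) x).right_inv hy] at hs
    set b := (extChartAt 𝓘(ℝ, E) x).symm y with hbdef
    have hb : b ∈ t.baseSet := hy'
    have hinv : (t.symmL ℝ b).inverse (FiberBundle.extend E u b) = (t ⟨x, u⟩).2 := by
      rw [← Trivialization.symm_continuousLinearEquivAt_eq' (R := ℝ) t hb,
        ContinuousLinearMap.inverse_equiv]
      have h1 : FiberBundle.extend E u b = t.symmL ℝ b (t ⟨x, u⟩).2 :=
        (t.symmL_apply (R := ℝ) hb _).symm
      rw [h1, ← Trivialization.symm_continuousLinearEquivAt_eq' (R := ℝ) t hb]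
      simp [t.apply_mk_symm hb]
    exact (congrArg (fun A : E →L[ℝ] TangentSpace 𝓘(ℝ, E) b =>
      A.inverse (FiberBundle.extend E u b)) hs.symm).trans hinv
  obtain ⟨a, ha⟩ := key u
  obtain ⟨b, hb⟩ := key v
  rw [← VectorField.mlieBracketWithin_univ, VectorField.mlieBracketWithin_apply,
    ha.lieBracketWithin_vectorField_eq_nhds hb]
  have : VectorField.lieBracketWithin ℝ (fun _ : E => a) (fun _ => b)
      ((extChartAt 𝓘(ℝ, E) x).symm ⁻¹' Set.univ ∩ Set.range 𝓘(ℝ, E))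
        (extChartAt 𝓘(ℝ, E) x x) = 0 := by
    simp [VectorField.lieBracketWithin]
  exact (congrArg _ this).trans (map_zero _)

end Ambient

/-! ### Conformal change of the Levi-Civita connection and the formula for ∇J -/

section Conformal

set_option linter.unusedSectionVars false

variable {E : Type*} [NormedAddCommGroup E] [NormedSpace ℂ E] [FiniteDimensional ℂ E]
  {M : Type*} [TopologicalSpace M] [ChartedSpace E M] [IsManifold 𝓘(ℝ, E) ∞ M]
  [RiemannianBundle (fun x : M => TangentSpace 𝓘(ℝ, E) x)]

theorem inner_leeVector (α : Π x : M, TangentSpace 𝓘(ℝ, E) x →L[ℝ] ℝ) (x : M)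
    (v : TangentSpace 𝓘(ℝ, E) x) : ⟪leeVector α x, v⟫_ℝ = α x v := by
  simp [leeVector]

theorem DiffAt.inner [IsContMDiffRiemannianBundle 𝓘(ℝ, E) ∞ E (fun x : M => TangentSpace 𝓘(ℝ, E) x)]
    {Y Z : Π x : M, TangentSpace 𝓘(ℝ, E) x} {x : M} (hY : DiffAt Y x) (hZ : DiffAt Z x) :
    MDifferentiableAt 𝓘(ℝ, E) 𝓘(ℝ, ℝ) (fun y => ⟪Y y, Z y⟫_ℝ) x :=
  MDifferentiableAt.inner_bundle (b := fun y : M => y) hY hZ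

/-- The Levi-Civita connections of `g` and of `exp (-2 ρ) g` differ by a tensor which is determined
by `dρ`. -/
theorem inner_conformal_sub
    [IsContMDiffRiemannianBundle 𝓘(ℝ, E) ∞ E (fun x : M => TangentSpace 𝓘(ℝ, E) x)]
    {nabla nabla' : (Π x : M, TangentSpace 𝓘(ℝ, E) x) →
      (Π x : M, TangentSpace 𝓘(ℝ, E) x →L[ℝ] TangentSpace 𝓘(ℝ, E) x)}
    {ρ : M → ℝ} {U : Set M} (hn : IsLeviCivitaOn (metric E M) U nabla)
    (hn' : IsLeviCivitaOn (conformalMetric ρ) U nabla') {x : M} (hx : x ∈ U)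
    (hρ : MDifferentiableAt 𝓘(ℝ, E) 𝓘(ℝ, ℝ) ρ x)
    {Y : Π x : M, TangentSpace 𝓘(ℝ, E) x} (hY : DiffAt Y x) (u w : TangentSpace 𝓘(ℝ, E) x) :
    ⟪nabla' Y x u, w⟫_ℝ = ⟪nabla Y x u, w⟫_ℝ - mvfderiv 𝓘(ℝ, E) ρ x u * ⟪Y x, w⟫_ℝ
      - mvfderiv 𝓘(ℝ, E) ρ x (Y x) * ⟪u, w⟫_ℝ + mvfderiv 𝓘(ℝ, E) ρ x w * ⟪u, Y x⟫_ℝ := by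
  have : FiniteDimensional ℝ E := FiniteDimensional.complexToReal E
  -- Two covariant derivatives differ by a tensor D; torsion-freeness makes it symmetric, and the
  -- two metric conditions determine the symmetrization of g(D b a, c) in b and c.
  set D := IsCovariantDerivativeOn.difference hn'.isCovariantDerivativeOn
    hn.isCovariantDerivativeOn x with hD
  have hDapp : ∀ {Z : Π x : M, TangentSpace 𝓘(ℝ, E) x}, DiffAt Z x → ∀ a,
      nabla' Z x a = nabla Z x a + D (Z x) a := by
    intro Z hZ a
    rw [hD, IsCovariantDerivativeOn.difference_apply _ _ hx hZ]
    simp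
  have hsym : ∀ a b : TangentSpace 𝓘(ℝ, E) x, D a b = D b a := by
    intro a b
    have h1 := hn.torsion_free x hx _ _ (diffAt_extend a) (diffAt_extend b)
    have h2 := hn'.torsion_free x hx _ _ (diffAt_extend a) (diffAt_extend b)
    rw [hDapp (diffAt_extend a), hDapp (diffAt_extend b), ← h1] at h2
    simp only [FiberBundle.extend_apply_self] at h2
    have h3 : D b a - D a b = 0 := by
      rw [← sub_eq_zero.2 h2]
      abel
    exact (sub_eq_zero.1 h3).symm
  have hmet : ∀ a b c : TangentSpace 𝓘(ℝ, E) x,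
      ⟪D b a, c⟫_ℝ + ⟪D c a, b⟫_ℝ = -2 * mvfderiv 𝓘(ℝ, E) ρ x a * ⟪b, c⟫_ℝ := by
    intro a b c
    have h1 := hn.metric x hx _ _ (diffAt_extend b) (diffAt_extend c) a
    have h2 := hn'.metric x hx _ _ (diffAt_extend b) (diffAt_extend c) a
    have hin := (diffAt_extend b).inner (diffAt_extend c)
    have hexp : HasDerivAt (fun s : ℝ => Real.exp (-2 * s)) (Real.exp (-2 * ρ x) * -2) (ρ x) := by
      simpa using ((hasDerivAt_id (ρ x)).const_mul (-2)).exp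
    have hdexp : MDifferentiableAt 𝓘(ℝ, E) 𝓘(ℝ, ℝ) (fun y => Real.exp (-2 * ρ y)) x :=
      (hexp.differentiableAt.mdifferentiableAt).comp x hρ
    have hfun : (fun y => conformalMetric ρ y (FiberBundle.extend E b y)
        (FiberBundle.extend E c y)) = fun y => Real.exp (-2 * ρ y) *
          ⟪(FiberBundle.extend E b y : TangentSpace 𝓘(ℝ, E) y), FiberBundle.extend E c y⟫_ℝ := rfl
    have hfun' : (fun y => metric E M y (FiberBundle.extend E b y)
        (FiberBundle.extend E c y)) = fun y =>
          ⟪(FiberBundle.extend E b y : TangentSpace 𝓘(ℝ, E) y), FiberBundle.extend E c y⟫_ℝ := rfl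
    have hconf : ∀ v w : TangentSpace 𝓘(ℝ, E) x,
      conformalMetric ρ x v w = Real.exp (-2 * ρ x) * ⟪v, w⟫_ℝ := fun v w => rfl
    have hmetric : ∀ v w : TangentSpace 𝓘(ℝ, E) x, metric E M x v w = ⟪v, w⟫_ℝ := fun v w => rfl
    rw [hfun', hmetric, hmetric] at h1
    rw [hfun, mvfderiv_fun_mul hdexp hin, hconf, hconf, hDapp (diffAt_extend b),
      hDapp (diffAt_extend c)] at h2
    simp only [add_apply, smul_apply, smul_eq_mul, h1,
      mvfderiv_comp_real hexp hρ, FiberBundle.extend_apply_self, inner_add_left,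
      inner_add_right] at h2
    have hpos := Real.exp_pos (-2 * ρ x)
    refine mul_left_cancel₀ hpos.ne' ?_
    rw [real_inner_comm b (D c a)]
    linarith
  rw [hDapp hY, inner_add_left]
  -- As in the Koszul formula, `e1 + e2 - e3` isolates 2 g(D(Y,u),w) once D is symmetric.
  have e1 := hmet u (Y x) w
  have e2 := hmet (Y x) u w
  have e3 := hmet w u (Y x)
  rw [hsym w u] at e1
  rw [hsym u (Y x), hsym w (Y x)] at e2
  rw [real_inner_comm (Y x) u] at *
  linarith

/-- The covariant derivative of `J` on an LCK manifold. -/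
theorem nabla_J
    [IsContMDiffRiemannianBundle 𝓘(ℝ, E) ∞ E (fun x : M => TangentSpace 𝓘(ℝ, E) x)]
    {C : ComplexStructure E M} {α : Π x : M, TangentSpace 𝓘(ℝ, E) x →L[ℝ] ℝ} (hα : IsLCK C α)
    {nabla : (Π x : M, TangentSpace 𝓘(ℝ, E) x) →
      (Π x : M, TangentSpace 𝓘(ℝ, E) x →L[ℝ] TangentSpace 𝓘(ℝ, E) x)}
    (hn : IsLeviCivitaOn (metric E M) Set.univ nabla) {x : M}
    {Y : Π x : M, TangentSpace 𝓘(ℝ, E) x} (hY : DiffAt Y x) (u : TangentSpace 𝓘(ℝ, E) x) :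
    nabla (fun y => C.J y (Y y)) x u = C.J x (nabla Y x u)
      + α x (C.J x (Y x)) • u - ⟪u, C.J x (Y x)⟫_ℝ • leeVector α x
      - α x (Y x) • C.J x u + ⟪u, Y x⟫_ℝ • C.J x (leeVector α x) := by
  obtain ⟨U, hU, hxU, ρ, hρ, ⟨-, nabla', hn', hJ⟩, hαρ⟩ := hα.locally_conformal x
  have hskew : ∀ a b : TangentSpace 𝓘(ℝ, E) x, ⟪C.J x a, b⟫_ℝ = -⟪a, C.J x b⟫_ℝ := by
    intro a b
    rw [← hα.hermitian x a (C.J x b), C.sq, inner_neg_right, neg_neg]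
  have hnU : IsLeviCivitaOn (metric E M) U nabla :=
    ⟨hn.isCovariantDerivativeOn.mono (Set.subset_univ U), fun x _ => hn.torsion_free x trivial,
      fun x _ => hn.metric x trivial⟩
  have hρx : MDifferentiableAt 𝓘(ℝ, E) 𝓘(ℝ, ℝ) ρ x :=
    ((hρ x hxU).contMDiffAt (hU.mem_nhds hxU)).mdifferentiableAt (by simp)
  refine ext_inner_right ℝ fun w => ?_
  -- Both sides of ∇'(JY) = J∇'Y are rewritten through ∇: JY is tested against w, and Y against Jw,
  -- J being skew.
  have e1 := inner_conformal_sub hnU hn' hxU hρx (diffAt_J C hY) u w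
  have e2 := inner_conformal_sub hnU hn' hxU hρx hY u (C.J x w)
  rw [hJ x hxU Y hY, hskew] at e1
  rw [← hαρ x hxU] at e1 e2
  simp only [inner_add_left, inner_sub_left, real_inner_smul_left, inner_leeVector, hskew]
  rw [hskew] at e1
  linarith

end Conformal

/-! ### Symmetry of second derivatives of a map between manifolds -/

section SecondDerivative

variable {EN : Type*} [NormedAddCommGroup EN] [NormedSpace ℝ EN]
  {HN : Type*} [TopologicalSpace HN] {I : ModelWithCorners ℝ EN HN}
  {N : Type*} [TopologicalSpace N] [ChartedSpace HN N] [IsManifold I ∞ N] [I.Boundaryless]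
  {EB : Type*} [NormedAddCommGroup EB] [NormedSpace ℝ EB]
  {HB : Type*} [TopologicalSpace HB] {IB : ModelWithCorners ℝ EB HB}
  {B : Type*} [TopologicalSpace B] [ChartedSpace HB B] [IsManifold IB ∞ B]

/-- In the charts at p and φ p, the extended field is a constant a, and the components of its image
under dφ are the directional derivatives DΦ(·)a of the coordinate expression Φ. Differentiating once
more gives D²Φ. -/
theorem mvfderiv_comps_mfderiv {φ : N → B} {p : N} (hφ : ContMDiff I IB ∞ φ)
    (u v : TangentSpace I p) :
    mvfderiv I (comps EB (V := (TangentSpace IB : B → Type _)) φ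
        (fun q => mfderiv I IB φ q (FiberBundle.extend EN v q)) p) p u
      = fderiv ℝ (fderiv ℝ (writtenInExtChartAt I IB p φ)) (extChartAt I p p)
        (mfderiv I 𝓘(ℝ, EN) (extChartAt I p) p u) (mfderiv I 𝓘(ℝ, EN) (extChartAt I p) p v) := by
  set Φ := writtenInExtChartAt I IB p φ with hΦ
  have hΦsm : ContDiffAt ℝ ∞ Φ (extChartAt I p p) := by
    have h := (contMDiffAt_iff.1 (hφ p)).2
    rw [I.range_eq_univ, contDiffWithinAt_univ] at h
    exact h
  set a : EN := mfderiv I 𝓘(ℝ, EN) (extChartAt I p) p v with ha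
  have hbase : (trivializationAt EN (TangentSpace I) p ⟨p, v⟩).2 = a := by
    have h := TangentBundle.continuousLinearMapAt_trivializationAt (I := I) (mem_chart_source HN p)
    refine Eq.trans ?_ (congrArg (fun A : TangentSpace I p →L[ℝ] EN => A v) h)
    change _ = (trivializationAt EN (TangentSpace I) p).continuousLinearMapAt ℝ p v
    rw [Trivialization.continuousLinearMapAt_apply, Trivialization.linearMapAt_apply,
      if_pos (FiberBundle.mem_baseSet_trivializationAt' p)]
  have hev : comps EB (V := (TangentSpace IB : B → Type _)) φ
        (fun q => mfderiv I IB φ q (FiberBundle.extend EN v q)) p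
      =ᶠ[nhds p] fun q => fderiv ℝ Φ (extChartAt I p q) a := by
    filter_upwards [(chartAt HN p).open_source.mem_nhds (mem_chart_source HN p),
      hφ.continuous.continuousAt.preimage_mem_nhds
        ((chartAt HB (φ p)).open_source.mem_nhds (mem_chart_source HB (φ p)))] with q hq hq'
    have hqs : q ∈ (extChartAt I p).source := by simpa using hq
    obtain ⟨z, hz, rfl⟩ : ∃ z ∈ (extChartAt I p).target, (extChartAt I p).symm z = q :=
      ⟨_, (extChartAt I p).map_source hqs, (extChartAt I p).left_inv hqs⟩
    have hz' := (extChartAt I p).right_inv hz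
    have h1 := TangentBundle.symmL_trivializationAt (I := I) hq
    rw [hz', I.range_eq_univ, mfderivWithin_univ] at h1
    rw [hz']
    have d1 : MDifferentiableAt 𝓘(ℝ, EN) I (extChartAt I p).symm z := by
      have := mdifferentiableWithinAt_extChartAt_symm hz
      rwa [I.range_eq_univ, mdifferentiableWithinAt_univ] at this
    have h2 := TangentBundle.continuousLinearMapAt_trivializationAt (I := IB)
      (show φ ((extChartAt I p).symm z) ∈ (chartAt HB (φ p)).source from hq')
    set q := (extChartAt I p).symm z with hqz
    have h3 : FiberBundle.extend EN v q
        = (trivializationAt EN (TangentSpace I) p).symmL ℝ q a := by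
      rw [← hbase]
      exact (Trivialization.symmL_apply (R := ℝ) _
        (show q ∈ (trivializationAt EN (TangentSpace I) p).baseSet from hq) _).symm
    have h4 : comps EB (V := (TangentSpace IB : B → Type _)) φ
        (fun q => mfderiv I IB φ q (FiberBundle.extend EN v q)) p q
        = (trivializationAt EB (TangentSpace IB) (φ p)).continuousLinearMapAt ℝ (φ q)
          (mfderiv I IB φ q (FiberBundle.extend EN v q)) := by
      rw [Trivialization.continuousLinearMapAt_apply, Trivialization.linearMapAt_apply,
        if_pos (show φ q ∈ (trivializationAt EB (TangentSpace IB) (φ p)).baseSet from hq')]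
      rfl
    have d2 : MDifferentiableAt I IB φ q := (hφ q).mdifferentiableAt (by simp)
    have d3 : MDifferentiableAt IB 𝓘(ℝ, EB) (extChartAt IB (φ p)) (φ q) :=
      mdifferentiableAt_extChartAt hq'
    have c : HasMFDerivAt 𝓘(ℝ, EN) 𝓘(ℝ, EB) Φ z _ :=
      HasMFDerivAt.comp (g := extChartAt IB (φ p) ∘ φ) z
        (d3.hasMFDerivAt.comp q d2.hasMFDerivAt) d1.hasMFDerivAt
    rw [h4, h3, h1, ← mfderiv_eq_fderiv]
    refine Eq.trans ?_ (congrArg (fun A : EN →L[ℝ] EB => A a) c.mfderiv).symm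
    exact congrArg (fun A : TangentSpace IB (φ q) →L[ℝ] EB => A (mfderiv I IB φ q
      (mfderiv 𝓘(ℝ, EN) I (extChartAt I p).symm z a))) h2
  rw [mvfderiv_congr hev]
  have hd : DifferentiableAt ℝ (fun z => fderiv ℝ Φ z a) (extChartAt I p p) := by
    have : DifferentiableAt ℝ (fderiv ℝ Φ) (extChartAt I p p) :=
      (hΦsm.fderiv_right (m := 1) (by norm_cast)).differentiableAt (by simp)
    exact this.clm_apply (differentiableAt_const a)
  have he : HasMFDerivAt I 𝓘(ℝ, EN) (extChartAt I p) p (mfderiv I 𝓘(ℝ, EN) (extChartAt I p) p) :=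
    (mdifferentiableAt_extChartAt (mem_chart_source HN p)).hasMFDerivAt
  have hc := (hd.hasFDerivAt.hasMFDerivAt.comp p he).mfderiv
  refine (congrArg (fun A : EN →L[ℝ] EB => A u) hc).trans ?_
  have hD : DifferentiableAt ℝ (fderiv ℝ Φ) (extChartAt I p p) :=
    (hΦsm.fderiv_right (m := 1) (by norm_cast)).differentiableAt (by simp)
  have hf : fderiv ℝ (fun z => fderiv ℝ Φ z a) (extChartAt I p p)
      = (fderiv ℝ (fderiv ℝ Φ) (extChartAt I p p)).flip a := by
    rw [fderiv_clm_apply hD (differentiableAt_const a)]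
    simp
  exact congrArg (fun A : EN →L[ℝ] EB => A (mfderiv I 𝓘(ℝ, EN) (extChartAt I p) p u)) hf

theorem mvfderiv_comps_mfderiv_symm {φ : N → B} {p : N} (hφ : ContMDiff I IB ∞ φ)
    (u v : TangentSpace I p) :
    mvfderiv I (comps EB (V := (TangentSpace IB : B → Type _)) φ
        (fun q => mfderiv I IB φ q (FiberBundle.extend EN v q)) p) p u
      = mvfderiv I (comps EB (V := (TangentSpace IB : B → Type _)) φ
        (fun q => mfderiv I IB φ q (FiberBundle.extend EN u q)) p) p v := by
  have hΦsm : ContDiffAt ℝ ∞ (writtenInExtChartAt I IB p φ) (extChartAt I p p) := by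
    have h := (contMDiffAt_iff.1 (hφ p)).2
    rw [I.range_eq_univ, contDiffWithinAt_univ] at h
    exact h
  rw [mvfderiv_comps_mfderiv hφ, mvfderiv_comps_mfderiv hφ]
  exact hΦsm.isSymmSndFDerivAt (by
    simpa using show ((2 : ℕ∞) : WithTop ℕ∞) ≤ ((⊤ : ℕ∞) : WithTop ℕ∞) from
      WithTop.coe_le_coe.2 le_top) _ _

end SecondDerivative

/-! ### The induced connection along a map: its compatibility with J and with the metric -/

section Along

set_option linter.unusedSectionVars false

variable {E : Type*} [NormedAddCommGroup E] [NormedSpace ℂ E] [FiniteDimensional ℂ E]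
  {M : Type*} [TopologicalSpace M] [ChartedSpace E M] [IsManifold 𝓘(ℝ, E) ∞ M]
  {E₁ : Type*} [NormedAddCommGroup E₁] [NormedSpace ℝ E₁]
  {N₁ : Type*} [TopologicalSpace N₁] [ChartedSpace E₁ N₁]
  {E₂ : Type*} [NormedAddCommGroup E₂] [NormedSpace ℝ E₂]
  {N₂ : Type*} [TopologicalSpace N₂] [ChartedSpace E₂ N₂]

/-- The vector field `V` along `φ` is differentiable at `p`. -/
def DiffAlong (φ : N₁ × N₂ → M) (V : Π q : N₁ × N₂, TangentSpace 𝓘(ℝ, E) (φ q))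
    (p : N₁ × N₂) : Prop :=
  MDifferentiableAt (prodModel E₁ E₂) 𝓘(ℝ, E).tangent
    (fun q => (⟨φ q, V q⟩ : TangentBundle 𝓘(ℝ, E) M)) p

theorem covDerivAlong_eq
    (nabla : (Π x : M, TangentSpace 𝓘(ℝ, E) x) →
      (Π x : M, TangentSpace 𝓘(ℝ, E) x →L[ℝ] TangentSpace 𝓘(ℝ, E) x))
    (φ : N₁ × N₂ → M) (V : Π q : N₁ × N₂, TangentSpace 𝓘(ℝ, E) (φ q)) (p : N₁ × N₂)
    (u : TProd E₁ E₂ p) :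
    covDerivAlong nabla φ V p u
      = (trivializationAt E (TangentSpace 𝓘(ℝ, E) : M → Type _) (φ p)).symmL ℝ (φ p)
          (mvfderiv (prodModel E₁ E₂) (comps E φ V p) p u)
        + nabla (FiberBundle.extend E (V p)) (φ p) (dmap E E₁ E₂ φ p u) := by
  rw [Trivialization.symmL_apply _ (FiberBundle.mem_baseSet_trivializationAt' (φ p))]
  rfl

theorem DiffAlong.J (C : ComplexStructure E M) {φ : N₁ × N₂ → M}
    {V : Π q : N₁ × N₂, TangentSpace 𝓘(ℝ, E) (φ q)} {p : N₁ × N₂}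
    (hφ : MDifferentiableAt (prodModel E₁ E₂) 𝓘(ℝ, E) φ p)
    (hV : DiffAlong (E₁ := E₁) (E₂ := E₂) φ V p) :
    DiffAlong (E₁ := E₁) (E₂ := E₂) φ (fun q => C.J (φ q) (V q)) p :=
  MDifferentiableAt.clm_bundle_apply (b := φ)
    (((C.smooth (φ p)).mdifferentiableAt (by simp)).comp p hφ) hV

/-- The components of V along φ are split off by the product rule. The part with components frozen
at p is the pull-back of an ambient field, to which `nabla_J` applies; the derivative of the
components enters linearly and J passes through it. -/
theorem covDerivAlong_J
    [RiemannianBundle (fun x : M => TangentSpace 𝓘(ℝ, E) x)]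
    [IsContMDiffRiemannianBundle 𝓘(ℝ, E) ∞ E (fun x : M => TangentSpace 𝓘(ℝ, E) x)]
    {C : ComplexStructure E M} {α : Π x : M, TangentSpace 𝓘(ℝ, E) x →L[ℝ] ℝ} (hα : IsLCK C α)
    {nabla : (Π x : M, TangentSpace 𝓘(ℝ, E) x) →
      (Π x : M, TangentSpace 𝓘(ℝ, E) x →L[ℝ] TangentSpace 𝓘(ℝ, E) x)}
    (hn : IsLeviCivitaOn (metric E M) Set.univ nabla)
    {φ : N₁ × N₂ → M} {V : Π q : N₁ × N₂, TangentSpace 𝓘(ℝ, E) (φ q)} {p : N₁ × N₂}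
    (hφ : MDifferentiableAt (prodModel E₁ E₂) 𝓘(ℝ, E) φ p)
    (hV : DiffAlong (E₁ := E₁) (E₂ := E₂) φ V p) (u : TProd E₁ E₂ p) :
    covDerivAlong nabla φ (fun q => C.J (φ q) (V q)) p u
      = C.J (φ p) (covDerivAlong nabla φ V p u)
        + α (φ p) (C.J (φ p) (V p)) • dmap E E₁ E₂ φ p u
        - ⟪dmap E E₁ E₂ φ p u, C.J (φ p) (V p)⟫_ℝ • leeVector α (φ p)
        - α (φ p) (V p) • C.J (φ p) (dmap E E₁ E₂ φ p u)
        + ⟪dmap E E₁ E₂ φ p u, V p⟫_ℝ • C.J (φ p) (leeVector α (φ p)) := by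
  set x := φ p with hx
  set t := trivializationAt E (TangentSpace 𝓘(ℝ, E) : M → Type _) x with ht
  have hxt : x ∈ t.baseSet := FiberBundle.mem_baseSet_trivializationAt' x
  have hev : ∀ᶠ q in nhds p, φ q ∈ t.baseSet := eventually_mem_baseSet hφ.continuousAt
  have hN := nabla_J hα hn (diffAt_extend (V p)) (dmap E E₁ E₂ φ p u)
  rw [nabla_eq_comps hn.isCovariantDerivativeOn (diffAt_J C (diffAt_extend (V p)))] at hN
  simp only [FiberBundle.extend_apply_self] at hN
  -- the components of `J V`
  have hprod : mvfderiv (prodModel E₁ E₂) (comps E φ (fun q => C.J (φ q) (V q)) p) p u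
      = mvfderiv 𝓘(ℝ, E) (comps E (fun y : M => y)
          (fun y => C.J y (FiberBundle.extend E (V p) y)) x) x (dmap E E₁ E₂ φ p u)
        + t.continuousLinearMapAt ℝ x (C.J x (t.symmL ℝ x
          (mvfderiv (prodModel E₁ E₂) (comps E φ V p) p u))) := by
    have hc : comps E φ (fun q => C.J (φ q) (V q)) p =ᶠ[nhds p]
        fun q => comps E φ (fun q' => C.J (φ q') (constSec E φ p (comps E φ V p q) q')) p q := by
      filter_upwards [hev] with q hq
      change (t ⟨φ q, C.J (φ q) (V q)⟩).2
        = (t ⟨φ q, C.J (φ q) (constSec E φ p (comps E φ V p q) q)⟩).2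
      rw [constSec_comps (s := V) hq]
    rw [mvfderiv_congr hc, mvfderiv_apply_linear
      (Ψ := fun q a => comps E φ (fun q' => C.J (φ q') (constSec E φ p a q')) p q)
      (c := comps E φ V p) ?_ (mdifferentiableAt_comps hV)
      ((t.continuousLinearMapAt ℝ x).comp ((C.J x).comp (t.symmL ℝ x))) ?_]
    · congr 1
      have hd : MDifferentiableAt 𝓘(ℝ, E) 𝓘(ℝ, E) (comps E (fun y : M => y)
          (fun y => C.J y (FiberBundle.extend E (V p) y)) x) (φ p) :=
        mdifferentiableAt_comps (diffAt_J C (diffAt_extend (V p)))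
      exact congrArg (fun A : TProd E₁ E₂ p →L[ℝ] E => A u) (mfderiv_comp p hd hφ)
    · have hJ : MDifferentiableAt ((prodModel E₁ E₂).prod 𝓘(ℝ, E)) 𝓘(ℝ, E).tangent
          (fun z : (N₁ × N₂) × E => (⟨φ z.1, C.J (φ z.1) (constSec E φ p z.2 z.1)⟩ :
            TangentBundle 𝓘(ℝ, E) M)) (p, comps E φ V p p) := by
        have hφ' : MDifferentiableAt ((prodModel E₁ E₂).prod 𝓘(ℝ, E)) 𝓘(ℝ, E)
            (fun z : (N₁ × N₂) × E => φ z.1) (p, comps E φ V p p) :=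
          MDifferentiableAt.comp (I' := prodModel E₁ E₂) (g := φ) _ hφ mdifferentiableAt_fst
        exact MDifferentiableAt.clm_bundle_apply (b := fun z : (N₁ × N₂) × E => φ z.1)
          (MDifferentiableAt.comp (p, comps E φ V p p)
            ((C.smooth (φ p)).mdifferentiableAt (by simp)) hφ')
          (mdifferentiableAt_constSec_prod hφ _)
      exact ((mdifferentiableAt_totalSpace _ _).1 hJ).2
    · intro a
      rw [ContinuousLinearMap.comp_apply, ContinuousLinearMap.comp_apply,
        Trivialization.symmL_apply _ hxt, Trivialization.continuousLinearMapAt_apply,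
        Trivialization.linearMapAt_apply, if_pos hxt]
      rfl
  rw [covDerivAlong_eq, covDerivAlong_eq, hprod, map_add, map_add,
    Trivialization.symmL_continuousLinearMapAt _ hxt]
  have hN' : ∀ a b c : TangentSpace 𝓘(ℝ, E) x, a + b = c → ∀ d, a + d + b = c + d := by
    intro a b c h d
    rw [← h]
    abel
  refine (hN' _ _ _ hN _).trans ?_
  abel

/-- Freezes the components of the first argument: the product rule leaves an ambient extension in
its place plus the term in which the components are differentiated. Used once for each argument, it
reduces metric compatibility along φ to that of `nabla` on M. -/
theorem mvfderiv_inner_left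
    [RiemannianBundle (fun x : M => TangentSpace 𝓘(ℝ, E) x)]
    [IsContMDiffRiemannianBundle 𝓘(ℝ, E) ∞ E (fun x : M => TangentSpace 𝓘(ℝ, E) x)]
    {φ : N₁ × N₂ → M} {V W : Π q : N₁ × N₂, TangentSpace 𝓘(ℝ, E) (φ q)} {p : N₁ × N₂}
    (hφ : MDifferentiableAt (prodModel E₁ E₂) 𝓘(ℝ, E) φ p)
    (hV : DiffAlong (E₁ := E₁) (E₂ := E₂) φ V p) (hW : DiffAlong (E₁ := E₁) (E₂ := E₂) φ W p)
    (u : TProd E₁ E₂ p) :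
    mvfderiv (prodModel E₁ E₂) (fun q => ⟪V q, W q⟫_ℝ) p u
      = mvfderiv (prodModel E₁ E₂) (fun q => ⟪FiberBundle.extend E (V p) (φ q), W q⟫_ℝ) p u
        + ⟪(trivializationAt E (TangentSpace 𝓘(ℝ, E) : M → Type _) (φ p)).symmL ℝ (φ p)
          (mvfderiv (prodModel E₁ E₂) (comps E φ V p) p u), W p⟫_ℝ := by
  set t := trivializationAt E (TangentSpace 𝓘(ℝ, E) : M → Type _) (φ p) with ht
  have hev : ∀ᶠ q in nhds p, φ q ∈ t.baseSet := eventually_mem_baseSet hφ.continuousAt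
  have hc : (fun q => ⟪V q, W q⟫_ℝ) =ᶠ[nhds p]
      fun q => ⟪(constSec E φ p (comps E φ V p q) q : TangentSpace 𝓘(ℝ, E) (φ q)), W q⟫_ℝ := by
    filter_upwards [hev] with q hq
    rw [constSec_comps (s := V) hq]
  rw [mvfderiv_congr hc, mvfderiv_apply_linear
    (Ψ := fun q a => ⟪(constSec E φ p a q : TangentSpace 𝓘(ℝ, E) (φ q)), W q⟫_ℝ)
    (c := comps E φ V p) ?_ (mdifferentiableAt_comps hV)
    ((innerSL ℝ (W p)).comp (t.symmL ℝ (φ p))) ?_]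
  · congr 1
    exact real_inner_comm (F := TangentSpace 𝓘(ℝ, E) (φ p)) _ _
  · have h2 : MDifferentiableAt ((prodModel E₁ E₂).prod 𝓘(ℝ, E)) 𝓘(ℝ, E).tangent
        (fun z : (N₁ × N₂) × E => (⟨φ z.1, W z.1⟩ : TangentBundle 𝓘(ℝ, E) M))
        (p, comps E φ V p p) :=
      MDifferentiableAt.comp (I' := prodModel E₁ E₂)
        (g := fun q => (⟨φ q, W q⟩ : TangentBundle 𝓘(ℝ, E) M)) _ hW mdifferentiableAt_fst
    exact MDifferentiableAt.inner_bundle (b := fun z : (N₁ × N₂) × E => φ z.1)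
      (mdifferentiableAt_constSec_prod hφ _) h2
  · intro a
    rw [ContinuousLinearMap.comp_apply,
      Trivialization.symmL_apply _ (FiberBundle.mem_baseSet_trivializationAt' (φ p))]
    exact (real_inner_comm (F := TangentSpace 𝓘(ℝ, E) (φ p)) _ _).symm

/-- The connection induced along a map is compatible with the metric. -/
theorem mvfderiv_inner_along
    [RiemannianBundle (fun x : M => TangentSpace 𝓘(ℝ, E) x)]
    [IsContMDiffRiemannianBundle 𝓘(ℝ, E) ∞ E (fun x : M => TangentSpace 𝓘(ℝ, E) x)]
    {nabla : (Π x : M, TangentSpace 𝓘(ℝ, E) x) →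
      (Π x : M, TangentSpace 𝓘(ℝ, E) x →L[ℝ] TangentSpace 𝓘(ℝ, E) x)}
    (hn : IsLeviCivitaOn (metric E M) Set.univ nabla)
    {φ : N₁ × N₂ → M} {V W : Π q : N₁ × N₂, TangentSpace 𝓘(ℝ, E) (φ q)} {p : N₁ × N₂}
    (hφ : MDifferentiableAt (prodModel E₁ E₂) 𝓘(ℝ, E) φ p)
    (hV : DiffAlong (E₁ := E₁) (E₂ := E₂) φ V p) (hW : DiffAlong (E₁ := E₁) (E₂ := E₂) φ W p)
    (u : TProd E₁ E₂ p) :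
    mvfderiv (prodModel E₁ E₂) (fun q => ⟪V q, W q⟫_ℝ) p u
      = ⟪covDerivAlong nabla φ V p u, W p⟫_ℝ + ⟪V p, covDerivAlong nabla φ W p u⟫_ℝ := by
  have hVc : DiffAlong (E₁ := E₁) (E₂ := E₂) φ
      (fun q => FiberBundle.extend E (V p) (φ q)) p :=
    MDifferentiableAt.comp p (diffAt_extend (V p)) hφ
  -- First V and then W is replaced by the pull-back of its ambient extension; the remaining
  -- function is g of two ambient fields composed with φ.
  have h1 := mvfderiv_inner_left hφ hV hW u
  have h2 := mvfderiv_inner_left hφ hW hVc u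
  have h3 := hn.metric (φ p) trivial _ _ (diffAt_extend (V p)) (diffAt_extend (W p))
    (dmap E E₁ E₂ φ p u)
  have hd := (diffAt_extend (V p)).inner (diffAt_extend (W p))
  have h4 : mvfderiv (prodModel E₁ E₂) (fun q => ⟪(FiberBundle.extend E (V p) (φ q) :
      TangentSpace 𝓘(ℝ, E) (φ q)), FiberBundle.extend E (W p) (φ q)⟫_ℝ) p u
      = mvfderiv 𝓘(ℝ, E) (fun y => ⟪(FiberBundle.extend E (V p) y :
      TangentSpace 𝓘(ℝ, E) y), FiberBundle.extend E (W p) y⟫_ℝ) (φ p) (dmap E E₁ E₂ φ p u) :=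
    congrArg (fun A : TProd E₁ E₂ p →L[ℝ] ℝ => A u) (mfderiv_comp p hd hφ)
  have hmetric : ∀ (x : M) (v w : TangentSpace 𝓘(ℝ, E) x), metric E M x v w = ⟪v, w⟫_ℝ :=
    fun _ _ _ => rfl
  simp only [hmetric, FiberBundle.extend_apply_self] at h3
  simp only [FiberBundle.extend_apply_self,
    fun q => real_inner_comm (FiberBundle.extend E (V p) (φ q) : TangentSpace 𝓘(ℝ, E) (φ q))] at h2
  rw [h1, covDerivAlong_eq, covDerivAlong_eq, inner_add_left, inner_add_right]
  rw [h2, h4, h3, real_inner_comm (V p)]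
  ring

end Along

/-! ### The Hessian of an immersion and the second fundamental form -/

section Hessian

set_option linter.unusedSectionVars false

variable {E : Type*} [NormedAddCommGroup E] [NormedSpace ℂ E] [FiniteDimensional ℂ E]
  {M : Type*} [TopologicalSpace M] [ChartedSpace E M] [IsManifold 𝓘(ℝ, E) ∞ M]
  {E₁ : Type*} [NormedAddCommGroup E₁] [NormedSpace ℝ E₁]
  {N₁ : Type*} [TopologicalSpace N₁] [ChartedSpace E₁ N₁] [IsManifold 𝓘(ℝ, E₁) ∞ N₁]
  {E₂ : Type*} [NormedAddCommGroup E₂] [NormedSpace ℝ E₂]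
  {N₂ : Type*} [TopologicalSpace N₂] [ChartedSpace E₂ N₂] [IsManifold 𝓘(ℝ, E₂) ∞ N₂]

/-- The extension of a tangent vector of `N₁ × N₂` to a field which is constant in the chart. -/
abbrev constField {p : N₁ × N₂} (v : TProd E₁ E₂ p) (q : N₁ × N₂) : TProd E₁ E₂ q :=
  FiberBundle.extend (E₁ × E₂) v q

theorem mdifferentiableAt_constField {p : N₁ × N₂} (v : TProd E₁ E₂ p) :
    MDifferentiableAt (prodModel E₁ E₂) (prodModel E₁ E₂).tangent
      (fun q => (⟨q, constField v q⟩ : TangentBundle (prodModel E₁ E₂) (N₁ × N₂))) p :=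
  FiberBundle.mdifferentiableAt_extend (prodModel E₁ E₂) (E₁ × E₂) v

theorem diffAlong_dmap {φ : N₁ × N₂ → M} (hφ : ContMDiff (prodModel E₁ E₂) 𝓘(ℝ, E) ∞ φ)
    {Y : Π q : N₁ × N₂, TProd E₁ E₂ q} {p : N₁ × N₂}
    (hY : MDifferentiableAt (prodModel E₁ E₂) (prodModel E₁ E₂).tangent
      (fun q => (⟨q, Y q⟩ : TangentBundle (prodModel E₁ E₂) (N₁ × N₂))) p) :
    DiffAlong (E₁ := E₁) (E₂ := E₂) φ (fun q => dmap E E₁ E₂ φ q (Y q)) p := by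
  have h := (hφ.contMDiff_tangentMap (m := 1) (by norm_cast)).mdifferentiable (by simp)
  exact MDifferentiableAt.comp p (h _) hY

/-- The Hessian of `φ`: the derivative `∇_u (dφ v)`, with `v` extended by a field which is
constant in the chart. -/
def hessian
    (nabla : (Π x : M, TangentSpace 𝓘(ℝ, E) x) →
      (Π x : M, TangentSpace 𝓘(ℝ, E) x →L[ℝ] TangentSpace 𝓘(ℝ, E) x))
    (φ : N₁ × N₂ → M) (p : N₁ × N₂) (u v : TProd E₁ E₂ p) : TangentSpace 𝓘(ℝ, E) (φ p) :=
  covDerivAlong nabla φ (fun q => dmap E E₁ E₂ φ q (constField v q)) p u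

/-- The component term is symmetric because the second derivative of φ in charts is; the connection
term is symmetric because ∇ is torsion free and the extensions used have vanishing bracket at φ p.
-/
theorem hessian_symm
    [RiemannianBundle (fun x : M => TangentSpace 𝓘(ℝ, E) x)]
    {nabla : (Π x : M, TangentSpace 𝓘(ℝ, E) x) →
      (Π x : M, TangentSpace 𝓘(ℝ, E) x →L[ℝ] TangentSpace 𝓘(ℝ, E) x)}
    (hn : IsLeviCivitaOn (metric E M) Set.univ nabla)
    {φ : N₁ × N₂ → M} (hφ : ContMDiff (prodModel E₁ E₂) 𝓘(ℝ, E) ∞ φ) (p : N₁ × N₂)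
    (u v : TProd E₁ E₂ p) : hessian nabla φ p u v = hessian nabla φ p v u := by
  have h1 := hn.torsion_free (φ p) trivial _ _ (diffAt_extend (dmap E E₁ E₂ φ p u))
    (diffAt_extend (dmap E E₁ E₂ φ p v))
  rw [mlieBracket_extend, sub_eq_zero] at h1
  simp only [FiberBundle.extend_apply_self] at h1
  rw [hessian, hessian, covDerivAlong_eq, covDerivAlong_eq]
  congr 1
  · exact congrArg _ (mvfderiv_comps_mfderiv_symm hφ u v)
  · simpa only [FiberBundle.extend_apply_self] using h1

/-- By the product rule, replacing the constant extension of Y p by Y itself only adds dφ of the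
derivative of the components of Y, and this is tangent to the submanifold. -/
theorem covDerivAlong_dmap
    (nabla : (Π x : M, TangentSpace 𝓘(ℝ, E) x) →
      (Π x : M, TangentSpace 𝓘(ℝ, E) x →L[ℝ] TangentSpace 𝓘(ℝ, E) x))
    {φ : N₁ × N₂ → M} (hφ : ContMDiff (prodModel E₁ E₂) 𝓘(ℝ, E) ∞ φ)
    {Y : Π q : N₁ × N₂, TProd E₁ E₂ q} {p : N₁ × N₂}
    (hY : MDifferentiableAt (prodModel E₁ E₂) (prodModel E₁ E₂).tangent
      (fun q => (⟨q, Y q⟩ : TangentBundle (prodModel E₁ E₂) (N₁ × N₂))) p)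
    (u : TProd E₁ E₂ p) :
    ∃ w : TProd E₁ E₂ p, covDerivAlong nabla φ (fun q => dmap E E₁ E₂ φ q (Y q)) p u
      = hessian nabla φ p u (Y p) + dmap E E₁ E₂ φ p w := by
  set t := trivializationAt E (TangentSpace 𝓘(ℝ, E) : M → Type _) (φ p) with ht
  set s := trivializationAt (E₁ × E₂) (TangentSpace (prodModel E₁ E₂) : N₁ × N₂ → Type _) p with hs
  have hpt : φ p ∈ t.baseSet := FiberBundle.mem_baseSet_trivializationAt' (φ p)
  have hps : p ∈ s.baseSet := FiberBundle.mem_baseSet_trivializationAt' p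
  have hev : ∀ᶠ q in nhds p, q ∈ s.baseSet := s.open_baseSet.mem_nhds hps
  set c : N₁ × N₂ → E₁ × E₂ := comps (E₁ × E₂) (fun q : N₁ × N₂ => q) Y p with hcdef
  refine ⟨s.symmL ℝ p (mvfderiv (prodModel E₁ E₂) c p u), ?_⟩
  have hprod : mvfderiv (prodModel E₁ E₂) (comps E φ (fun q => dmap E E₁ E₂ φ q (Y q)) p) p u
      = mvfderiv (prodModel E₁ E₂)
          (comps E φ (fun q => dmap E E₁ E₂ φ q (constField (Y p) q)) p) p u
        + t.continuousLinearMapAt ℝ (φ p) (dmap E E₁ E₂ φ p (s.symmL ℝ p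
          (mvfderiv (prodModel E₁ E₂) c p u))) := by
    have hc : comps E φ (fun q => dmap E E₁ E₂ φ q (Y q)) p =ᶠ[nhds p]
        fun q => comps E φ (fun q' => dmap E E₁ E₂ φ q'
          (constSec (E₁ × E₂) (fun q : N₁ × N₂ => q) p (c q) q')) p q := by
      filter_upwards [hev] with q hq
      change (t ⟨φ q, dmap E E₁ E₂ φ q (Y q)⟩).2 = (t ⟨φ q, dmap E E₁ E₂ φ q
        (constSec (E₁ × E₂) (fun q : N₁ × N₂ => q) p (c q) q)⟩).2
      rw [hcdef, constSec_comps (s := Y) hq]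
    rw [mvfderiv_congr hc, mvfderiv_apply_linear
      (Ψ := fun q a => comps E φ (fun q' => dmap E E₁ E₂ φ q'
          (constSec (E₁ × E₂) (fun q : N₁ × N₂ => q) p a q')) p q)
      (c := c) ?_ (mdifferentiableAt_comps hY)
      ((t.continuousLinearMapAt ℝ (φ p)).comp ((dmap E E₁ E₂ φ p).comp (s.symmL ℝ p))) ?_]
    · rfl
    · have hd : MDifferentiableAt ((prodModel E₁ E₂).prod 𝓘(ℝ, E₁ × E₂)) 𝓘(ℝ, E).tangent
          (fun z : (N₁ × N₂) × (E₁ × E₂) => (⟨φ z.1, dmap E E₁ E₂ φ z.1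
            (constSec (E₁ × E₂) (fun q : N₁ × N₂ => q) p z.2 z.1)⟩ :
            TangentBundle 𝓘(ℝ, E) M)) (p, c p) := by
        have h := (hφ.contMDiff_tangentMap (m := 1) (by norm_cast)).mdifferentiable (by simp)
        exact MDifferentiableAt.comp (p, c p) (h _) (mdifferentiableAt_constSec_prod
          (V := (TangentSpace (prodModel E₁ E₂) : N₁ × N₂ → Type _))
          (φ := fun q : N₁ × N₂ => q) mdifferentiableAt_id (c p))
      exact ((mdifferentiableAt_totalSpace _ _).1 hd).2
    · intro a
      rw [ContinuousLinearMap.comp_apply, ContinuousLinearMap.comp_apply,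
        Trivialization.symmL_apply _ hps, Trivialization.continuousLinearMapAt_apply,
        Trivialization.linearMapAt_apply, if_pos hpt]
      rfl
  rw [hessian, covDerivAlong_eq, covDerivAlong_eq, hprod, map_add,
    Trivialization.symmL_continuousLinearMapAt _ hpt]
  simp only [FiberBundle.extend_apply_self]
  abel

theorem secondFF_eq_hessian
    [RiemannianBundle (fun x : M => TangentSpace 𝓘(ℝ, E) x)]
    (nabla : (Π x : M, TangentSpace 𝓘(ℝ, E) x) →
      (Π x : M, TangentSpace 𝓘(ℝ, E) x →L[ℝ] TangentSpace 𝓘(ℝ, E) x))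
    {φ : N₁ × N₂ → M} (hφ : ContMDiff (prodModel E₁ E₂) 𝓘(ℝ, E) ∞ φ)
    (X : Π q : N₁ × N₂, TProd E₁ E₂ q)
    {Y : Π q : N₁ × N₂, TProd E₁ E₂ q} (hY : SmoothField Y) (p : N₁ × N₂) :
    secondFF nabla φ X Y p = normalPart E₁ E₂ φ p (hessian nabla φ p (X p) (Y p)) := by
  obtain ⟨w, hw⟩ := covDerivAlong_dmap nabla hφ ((hY p).mdifferentiableAt (by simp)) (X p)
  have h0 : normalPart E₁ E₂ φ p (dmap E E₁ E₂ φ p w) = 0 := by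
    rw [normalPart, Submodule.starProjection_apply_eq_zero_iff, Submodule.orthogonal_orthogonal]
    exact ⟨w, rfl⟩
  rw [secondFF, hw, normalPart, map_add]
  change normalPart E₁ E₂ φ p _ + normalPart E₁ E₂ φ p _ = _
  rw [h0, add_zero]

end Hessian

/-! ### Projections of chart-constant fields on a product -/

section LinearInCharts

variable {EN : Type*} [NormedAddCommGroup EN] [NormedSpace ℝ EN]
  {HN : Type*} [TopologicalSpace HN] {I : ModelWithCorners ℝ EN HN}
  {N : Type*} [TopologicalSpace N] [ChartedSpace HN N] [IsManifold I ∞ N] [I.Boundaryless]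
  {EB : Type*} [NormedAddCommGroup EB] [NormedSpace ℝ EB]
  {HB : Type*} [TopologicalSpace HB] {IB : ModelWithCorners ℝ EB HB}
  {B : Type*} [TopologicalSpace B] [ChartedSpace HB B] [IsManifold IB ∞ B] [IB.Boundaryless]

/-- A map which is linear in the charts sends fields that are constant in the chart to fields
that are constant in the chart. -/
theorem mfderiv_extend_eventually {g : N → B} {p : N} (hg : MDifferentiable I IB g)
    (L : EN →L[ℝ] EB) (hL : ∀ z ∈ (extChartAt I p).target,
      L z ∈ (extChartAt IB (g p)).target ∧
        g ((extChartAt I p).symm z) = (extChartAt IB (g p)).symm (L z))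
    (v : TangentSpace I p) :
    ∀ᶠ q in nhds p, mfderiv I IB g q (FiberBundle.extend EN v q)
      = FiberBundle.extend EB (mfderiv I IB g p v) (g q) := by
  set s := trivializationAt EN (TangentSpace I : N → Type _) p with hs
  set t := trivializationAt EB (TangentSpace IB : B → Type _) (g p) with ht
  -- The inverse trivializations are the derivatives of the inverse charts, so this is the chain
  -- rule applied to g ∘ (chart at p)⁻¹ = (chart at g p)⁻¹ ∘ L.
  have hsymm : ∀ q ∈ (chartAt HN p).source, ∀ a : EN,
      mfderiv I IB g q (s.symmL ℝ q a) = t.symmL ℝ (g q) (L a) := by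
    intro q hq a
    have hqs : q ∈ (extChartAt I p).source := by
      rwa [extChartAt_source]
    obtain ⟨z, hz, rfl⟩ : ∃ z ∈ (extChartAt I p).target, (extChartAt I p).symm z = q :=
      ⟨_, (extChartAt I p).map_source hqs, (extChartAt I p).left_inv hqs⟩
    obtain ⟨hLz, hgz⟩ := hL z hz
    have h1 := TangentBundle.symmL_trivializationAt (I := I) hq
    rw [(extChartAt I p).right_inv hz, I.range_eq_univ, mfderivWithin_univ] at h1
    have hq1 : (extChartAt IB (g p)).symm (L z) ∈ (chartAt HB (g p)).source := by
      simpa using (extChartAt IB (g p)).map_target hLz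
    have h2 := TangentBundle.symmL_trivializationAt (I := IB) hq1
    rw [(extChartAt IB (g p)).right_inv hLz, IB.range_eq_univ, mfderivWithin_univ] at h2
    have d1 : MDifferentiableAt 𝓘(ℝ, EN) I (extChartAt I p).symm z := by
      have := mdifferentiableWithinAt_extChartAt_symm hz
      rwa [I.range_eq_univ, mdifferentiableWithinAt_univ] at this
    have d2 : MDifferentiableAt 𝓘(ℝ, EB) IB (extChartAt IB (g p)).symm (L z) := by
      have := mdifferentiableWithinAt_extChartAt_symm hLz
      rwa [IB.range_eq_univ, mdifferentiableWithinAt_univ] at this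
    have c1 := (hg ((extChartAt I p).symm z)).hasMFDerivAt.comp z d1.hasMFDerivAt
    have c2 := d2.hasMFDerivAt.comp z L.hasFDerivAt.hasMFDerivAt
    have hcomp : (extChartAt IB (g p)).symm ∘ L =ᶠ[nhds z] g ∘ (extChartAt I p).symm := by
      filter_upwards [(isOpen_extChartAt_target (I := I) p).mem_nhds hz] with y hy
      exact (hL y hy).2.symm
    have c3 := congrArg (fun A : EN →L[ℝ] EB => A a)
      (hasMFDerivAt_unique c1 (c2.congr_of_eventuallyEq hcomp.symm))
    have h3 := congrArg (fun y : B => (t.symmL ℝ y (L a) : EB)) hgz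
    refine Eq.trans ?_ h3.symm
    refine Eq.trans ?_ (congrArg (fun A : EB →L[ℝ] EB => A (L a)) h2).symm
    refine Eq.trans ?_ c3
    exact congrArg (fun A : EN →L[ℝ] TangentSpace I ((extChartAt I p).symm z) =>
      mfderiv I IB g ((extChartAt I p).symm z) (A a)) h1
  have hps : p ∈ s.baseSet := FiberBundle.mem_baseSet_trivializationAt' p
  have hpt : g p ∈ t.baseSet := FiberBundle.mem_baseSet_trivializationAt' (g p)
  have hval : (t ⟨g p, mfderiv I IB g p v⟩).2 = L (s ⟨p, v⟩).2 := by
    have h := hsymm p (mem_chart_source HN p) (s ⟨p, v⟩).2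
    rw [s.symmL_apply hps, s.symm_apply_apply_mk hps, t.symmL_apply hpt] at h
    rw [h, t.apply_mk_symm hpt]
  filter_upwards [(chartAt HN p).open_source.mem_nhds (mem_chart_source HN p),
    (hg p).continuousAt.preimage_mem_nhds (t.open_baseSet.mem_nhds hpt)] with q hq hq'
  have h := hsymm q hq (s ⟨p, v⟩).2
  rw [s.symmL_apply (show q ∈ s.baseSet from hq), t.symmL_apply hq', ← hval] at h
  exact h

end LinearInCharts

section WarpedMetric

set_option linter.unusedSectionVars false

variable {E₁ : Type*} [NormedAddCommGroup E₁] [NormedSpace ℝ E₁]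
  {N₁ : Type*} [TopologicalSpace N₁] [ChartedSpace E₁ N₁] [IsManifold 𝓘(ℝ, E₁) ∞ N₁]
  {E₂ : Type*} [NormedAddCommGroup E₂] [NormedSpace ℝ E₂]
  {N₂ : Type*} [TopologicalSpace N₂] [ChartedSpace E₂ N₂] [IsManifold 𝓘(ℝ, E₂) ∞ N₂]

theorem dπ₁_constField {p : N₁ × N₂} (v : TProd E₁ E₂ p) :
    ∀ᶠ q in nhds p, dπ₁ q (constField v q)
      = FiberBundle.extend E₁ (dπ₁ p v : TangentSpace 𝓘(ℝ, E₁) p.1) q.1 := by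
  refine mfderiv_extend_eventually (g := Prod.fst) mdifferentiable_fst
    (ContinuousLinearMap.fst ℝ E₁ E₂) (fun z hz => ?_) v
  rw [extChartAt_prod] at hz ⊢
  exact ⟨hz.1, rfl⟩

theorem dπ₂_constField {p : N₁ × N₂} (v : TProd E₁ E₂ p) :
    ∀ᶠ q in nhds p, dπ₂ q (constField v q)
      = FiberBundle.extend E₂ (dπ₂ p v : TangentSpace 𝓘(ℝ, E₂) p.2) q.2 := by
  refine mfderiv_extend_eventually (g := Prod.snd) mdifferentiable_snd
    (ContinuousLinearMap.snd ℝ E₁ E₂) (fun z hz => ?_) v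
  rw [extChartAt_prod] at hz ⊢
  exact ⟨hz.2, rfl⟩

end WarpedMetric

section ExtendZero

variable {EN : Type*} [NormedAddCommGroup EN] [NormedSpace ℝ EN]
  {N : Type*} [TopologicalSpace N] [ChartedSpace EN N] [IsManifold 𝓘(ℝ, EN) ∞ N]

theorem extend_zero_eventually (x : N) : ∀ᶠ y in nhds x,
    FiberBundle.extend EN (0 : TangentSpace 𝓘(ℝ, EN) x) y = (0 : TangentSpace 𝓘(ℝ, EN) y) := by
  set t := trivializationAt EN (TangentSpace 𝓘(ℝ, EN) : N → Type _) x with ht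
  have hx : x ∈ t.baseSet := FiberBundle.mem_baseSet_trivializationAt' x
  filter_upwards [t.open_baseSet.mem_nhds hx] with y hy
  change t.symm y (t ⟨x, 0⟩).2 = 0
  have h : (t ⟨x, 0⟩).2 = (0 : EN) := congrArg Prod.snd (t.zeroSection ℝ hx)
  rw [h, ← t.symmL_apply (R := ℝ) hy, map_zero]

end ExtendZero

section Distributions

variable {E₁ : Type*} [NormedAddCommGroup E₁] [NormedSpace ℝ E₁]
  {N₁ : Type*} [TopologicalSpace N₁] [ChartedSpace E₁ N₁]
  {E₂ : Type*} [NormedAddCommGroup E₂] [NormedSpace ℝ E₂]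
  {N₂ : Type*} [TopologicalSpace N₂] [ChartedSpace E₂ N₂]

theorem mem_dist₁ {p : N₁ × N₂} {v : TProd E₁ E₂ p} : v ∈ dist₁ E₁ E₂ p ↔ dπ₂ p v = 0 :=
  Iff.rfl

theorem mem_dist₂ {p : N₁ × N₂} {v : TProd E₁ E₂ p} : v ∈ dist₂ E₁ E₂ p ↔ dπ₁ p v = 0 :=
  Iff.rfl

end Distributions

/-! ### Derivatives of the warped metric coefficients -/

section WarpedDerivative

set_option linter.unusedSectionVars false

variable {E₁ : Type*} [NormedAddCommGroup E₁] [NormedSpace ℝ E₁]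
  {N₁ : Type*} [TopologicalSpace N₁] [ChartedSpace E₁ N₁] [IsManifold 𝓘(ℝ, E₁) ∞ N₁]
  [RiemannianBundle (fun x : N₁ => TangentSpace 𝓘(ℝ, E₁) x)]
  [IsContMDiffRiemannianBundle 𝓘(ℝ, E₁) ∞ E₁ (fun x : N₁ => TangentSpace 𝓘(ℝ, E₁) x)]
  {E₂ : Type*} [NormedAddCommGroup E₂] [NormedSpace ℝ E₂]
  {N₂ : Type*} [TopologicalSpace N₂] [ChartedSpace E₂ N₂] [IsManifold 𝓘(ℝ, E₂) ∞ N₂]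
  [RiemannianBundle (fun x : N₂ => TangentSpace 𝓘(ℝ, E₂) x)]
  [IsContMDiffRiemannianBundle 𝓘(ℝ, E₂) ∞ E₂ (fun x : N₂ => TangentSpace 𝓘(ℝ, E₂) x)]

variable {EN : Type*} [NormedAddCommGroup EN] [NormedSpace ℝ EN]
  {N : Type*} [TopologicalSpace N] [ChartedSpace EN N] [IsManifold 𝓘(ℝ, EN) ∞ N]
  [RiemannianBundle (fun x : N => TangentSpace 𝓘(ℝ, EN) x)]
  [IsContMDiffRiemannianBundle 𝓘(ℝ, EN) ∞ EN (fun x : N => TangentSpace 𝓘(ℝ, EN) x)]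

/-- The derivative of the metric coefficient `g(v, w)`, with `v`, `w` constant in the chart. -/
def metricDeriv {x : N} (v w u : TangentSpace 𝓘(ℝ, EN) x) : ℝ :=
  mvfderiv 𝓘(ℝ, EN) (fun y => ⟪(FiberBundle.extend EN v y : TangentSpace 𝓘(ℝ, EN) y),
    FiberBundle.extend EN w y⟫_ℝ) x u

theorem metricDeriv_zero_left {x : N} (w u : TangentSpace 𝓘(ℝ, EN) x) :
    metricDeriv 0 w u = 0 := by
  have h : (fun y => ⟪(FiberBundle.extend EN (0 : TangentSpace 𝓘(ℝ, EN) x) y :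
      TangentSpace 𝓘(ℝ, EN) y), FiberBundle.extend EN w y⟫_ℝ) =ᶠ[nhds x] fun _ => (0 : ℝ) := by
    filter_upwards [extend_zero_eventually (EN := EN) x] with y hy
    rw [hy, inner_zero_left]
  rw [metricDeriv, mvfderiv_congr h, mvfderiv_const]
  rfl

theorem metricDeriv_zero_right {x : N} (v u : TangentSpace 𝓘(ℝ, EN) x) :
    metricDeriv v 0 u = 0 := by
  rw [← metricDeriv_zero_left v u, metricDeriv, metricDeriv]
  simp_rw [fun y => real_inner_comm (FiberBundle.extend EN v y : TangentSpace 𝓘(ℝ, EN) y)]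

theorem metricDeriv_zero {x : N} (v w : TangentSpace 𝓘(ℝ, EN) x) :
    metricDeriv v w 0 = 0 := map_zero _

theorem mdifferentiableAt_inner_extend {x : N} (v w : TangentSpace 𝓘(ℝ, EN) x) :
    MDifferentiableAt 𝓘(ℝ, EN) 𝓘(ℝ, ℝ) (fun y => ⟪(FiberBundle.extend EN v y :
      TangentSpace 𝓘(ℝ, EN) y), FiberBundle.extend EN w y⟫_ℝ) x :=
  MDifferentiableAt.inner_bundle (b := fun y : N => y)
    (FiberBundle.mdifferentiableAt_extend 𝓘(ℝ, EN) EN v)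
    (FiberBundle.mdifferentiableAt_extend 𝓘(ℝ, EN) EN w)

/-- The derivative of a coefficient of the warped product metric. -/
theorem mvfderiv_warped {f : N₁ → ℝ} {p : N₁ × N₂}
    (hf : MDifferentiableAt 𝓘(ℝ, E₁) 𝓘(ℝ, ℝ) f p.1) (u v w : TProd E₁ E₂ p) :
    mvfderiv (prodModel E₁ E₂)
        (fun q => warped E₁ E₂ f q (constField v q) (constField w q)) p u
      = metricDeriv (dπ₁ p v) (dπ₁ p w) (dπ₁ p u)
        + f p.1 ^ 2 * metricDeriv (dπ₂ p v) (dπ₂ p w) (dπ₂ p u)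
        + 2 * f p.1 * mvfderiv (prodModel E₁ E₂) (fun q : N₁ × N₂ => f q.1) p u
          * ⟪dπ₂ p v, dπ₂ p w⟫_ℝ := by
  set h₁ : N₁ → ℝ := fun y => ⟪(FiberBundle.extend E₁ (dπ₁ p v : TangentSpace 𝓘(ℝ, E₁) p.1) y :
    TangentSpace 𝓘(ℝ, E₁) y), FiberBundle.extend E₁ (dπ₁ p w : TangentSpace 𝓘(ℝ, E₁) p.1) y⟫_ℝ
    with hh₁
  set h₂ : N₂ → ℝ := fun y => ⟪(FiberBundle.extend E₂ (dπ₂ p v : TangentSpace 𝓘(ℝ, E₂) p.2) y :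
    TangentSpace 𝓘(ℝ, E₂) y), FiberBundle.extend E₂ (dπ₂ p w : TangentSpace 𝓘(ℝ, E₂) p.2) y⟫_ℝ
    with hh₂
  -- Chart-constant fields on the product project to chart-constant fields on the factors, so the
  -- coefficient is a function on the first factor plus f² times a function on the second.
  have hev : (fun q => warped E₁ E₂ f q (constField v q) (constField w q))
      =ᶠ[nhds p] fun q : N₁ × N₂ => h₁ q.1 + f q.1 ^ 2 * h₂ q.2 := by
    filter_upwards [dπ₁_constField v, dπ₁_constField w, dπ₂_constField v, dπ₂_constField w]
      with q a b c d
    rw [warped, a, b, c, d]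
  have d₁ : MDifferentiableAt 𝓘(ℝ, E₁) 𝓘(ℝ, ℝ) h₁ p.1 := mdifferentiableAt_inner_extend _ _
  have d₂ : MDifferentiableAt 𝓘(ℝ, E₂) 𝓘(ℝ, ℝ) h₂ p.2 := mdifferentiableAt_inner_extend _ _
  have c₁ : MDifferentiableAt (prodModel E₁ E₂) 𝓘(ℝ, ℝ) (fun q : N₁ × N₂ => h₁ q.1) p :=
    MDifferentiableAt.comp p d₁ mdifferentiableAt_fst
  have c₂ : MDifferentiableAt (prodModel E₁ E₂) 𝓘(ℝ, ℝ) (fun q : N₁ × N₂ => h₂ q.2) p :=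
    MDifferentiableAt.comp p d₂ mdifferentiableAt_snd
  have cf : MDifferentiableAt (prodModel E₁ E₂) 𝓘(ℝ, ℝ) (fun q : N₁ × N₂ => f q.1) p :=
    MDifferentiableAt.comp p hf mdifferentiableAt_fst
  have hsq : HasDerivAt (fun s : ℝ => s ^ 2) (2 * f p.1) (f p.1) := by
    simpa using hasDerivAt_pow 2 (f p.1)
  have cf2 : MDifferentiableAt (prodModel E₁ E₂) 𝓘(ℝ, ℝ) (fun q : N₁ × N₂ => f q.1 ^ 2) p :=
    (hsq.differentiableAt.mdifferentiableAt).comp p cf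
  have e₁ : mvfderiv (prodModel E₁ E₂) (fun q : N₁ × N₂ => h₁ q.1) p u
      = metricDeriv (dπ₁ p v) (dπ₁ p w) (dπ₁ p u) :=
    congrArg (fun A : TProd E₁ E₂ p →L[ℝ] ℝ => A u) (mfderiv_comp p d₁ mdifferentiableAt_fst)
  have e₂ : mvfderiv (prodModel E₁ E₂) (fun q : N₁ × N₂ => h₂ q.2) p u
      = metricDeriv (dπ₂ p v) (dπ₂ p w) (dπ₂ p u) :=
    congrArg (fun A : TProd E₁ E₂ p →L[ℝ] ℝ => A u) (mfderiv_comp p d₂ mdifferentiableAt_snd)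
  have e₃ := mvfderiv_comp_real (g := fun q : N₁ × N₂ => f q.1) hsq cf u
  have e₄ : h₂ p.2 = ⟪dπ₂ p v, dπ₂ p w⟫_ℝ := by
    simp only [hh₂, FiberBundle.extend_apply_self]
  have c₃ : MDifferentiableAt (prodModel E₁ E₂) 𝓘(ℝ, ℝ)
      (fun q : N₁ × N₂ => f q.1 ^ 2 * h₂ q.2) p := cf2.mul c₂
  rw [mvfderiv_congr hev, mvfderiv_fun_add c₁ c₃, mvfderiv_fun_mul cf2 c₂]
  simp only [add_apply, smul_apply, smul_eq_mul, e₁, e₂, e₃, e₄]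
  ring

theorem derivLog_eq {f : N₁ → ℝ} {p : N₁ × N₂}
    (hf : MDifferentiableAt 𝓘(ℝ, E₁) 𝓘(ℝ, ℝ) f p.1) (hpos : 0 < f p.1) (u : TProd E₁ E₂ p) :
    derivLog f p u = (f p.1)⁻¹ * mvfderiv (prodModel E₁ E₂) (fun q : N₁ × N₂ => f q.1) p u :=
  mvfderiv_comp_real (g := fun q : N₁ × N₂ => f q.1) (Real.hasDerivAt_log hpos.ne')
    (MDifferentiableAt.comp p hf mdifferentiableAt_fst) u

theorem mvfderiv_warped_dist₁_dist₂ {f : N₁ → ℝ} {p : N₁ × N₂}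
    (hf : MDifferentiableAt 𝓘(ℝ, E₁) 𝓘(ℝ, ℝ) f p.1) (u : TProd E₁ E₂ p) {v w : TProd E₁ E₂ p}
    (hv : v ∈ dist₁ E₁ E₂ p) (hw : w ∈ dist₂ E₁ E₂ p) :
    mvfderiv (prodModel E₁ E₂)
        (fun q => warped E₁ E₂ f q (constField v q) (constField w q)) p u = 0 := by
  rw [mvfderiv_warped hf, mem_dist₁.1 hv, mem_dist₂.1 hw, metricDeriv_zero_right,
    metricDeriv_zero_left, inner_zero_left]
  ring

/-- Only the coefficient of g_T involves v, and it does not change in directions tangent to the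
second factor. -/
theorem mvfderiv_warped_dist₁_dist₁ {f : N₁ → ℝ} {p : N₁ × N₂}
    (hf : MDifferentiableAt 𝓘(ℝ, E₁) 𝓘(ℝ, ℝ) f p.1) {u v w : TProd E₁ E₂ p}
    (hu : u ∈ dist₂ E₁ E₂ p) (hv : v ∈ dist₁ E₁ E₂ p) :
    mvfderiv (prodModel E₁ E₂)
        (fun q => warped E₁ E₂ f q (constField v q) (constField w q)) p u = 0 := by
  rw [mvfderiv_warped hf, mem_dist₁.1 hv, mem_dist₂.1 hu, metricDeriv_zero,
    metricDeriv_zero_left, inner_zero_left]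
  ring

/-- In directions tangent to the first factor the coefficient of g_θ is fixed and only f² varies,
with d(f²) = 2 f² d(ln f). -/
theorem mvfderiv_warped_dist₂_dist₂ {f : N₁ → ℝ} {p : N₁ × N₂}
    (hf : MDifferentiableAt 𝓘(ℝ, E₁) 𝓘(ℝ, ℝ) f p.1) (hpos : 0 < f p.1) {u v w : TProd E₁ E₂ p}
    (hu : u ∈ dist₁ E₁ E₂ p) (hv : v ∈ dist₂ E₁ E₂ p) :
    mvfderiv (prodModel E₁ E₂)
        (fun q => warped E₁ E₂ f q (constField v q) (constField w q)) p u
      = 2 * derivLog f p u * warped E₁ E₂ f p v w := by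
  rw [mvfderiv_warped hf, mem_dist₁.1 hu, mem_dist₂.1 hv, metricDeriv_zero,
    metricDeriv_zero_left, derivLog_eq hf hpos, warped, mem_dist₂.1 hv, inner_zero_left]
  field_simp
  ring

end WarpedDerivative

/-! ### The two distributions and the warped metric -/

section Distributions

set_option linter.unusedSectionVars false

variable {E₁ : Type*} [NormedAddCommGroup E₁] [NormedSpace ℝ E₁]
  {N₁ : Type*} [TopologicalSpace N₁] [ChartedSpace E₁ N₁] [IsManifold 𝓘(ℝ, E₁) ∞ N₁]
  [RiemannianBundle (fun x : N₁ => TangentSpace 𝓘(ℝ, E₁) x)]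
  {E₂ : Type*} [NormedAddCommGroup E₂] [NormedSpace ℝ E₂]
  {N₂ : Type*} [TopologicalSpace N₂] [ChartedSpace E₂ N₂] [IsManifold 𝓘(ℝ, E₂) ∞ N₂]
  [RiemannianBundle (fun x : N₂ => TangentSpace 𝓘(ℝ, E₂) x)]

theorem constField_mem_dist₁ {p : N₁ × N₂} {v : TProd E₁ E₂ p} (hv : v ∈ dist₁ E₁ E₂ p) :
    ∀ᶠ q in nhds p, constField v q ∈ dist₁ E₁ E₂ q := by
  have h0 := (continuous_snd (X := N₁) (Y := N₂)).continuousAt (x := p) |>.eventually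
    (extend_zero_eventually (EN := E₂) p.2)
  filter_upwards [dπ₂_constField v, h0] with q h1 h2
  rw [mem_dist₁, h1, mem_dist₁.1 hv]
  exact h2

theorem constField_mem_dist₂ {p : N₁ × N₂} {v : TProd E₁ E₂ p} (hv : v ∈ dist₂ E₁ E₂ p) :
    ∀ᶠ q in nhds p, constField v q ∈ dist₂ E₁ E₂ q := by
  have h0 := (continuous_fst (X := N₁) (Y := N₂)).continuousAt (x := p) |>.eventually
    (extend_zero_eventually (EN := E₁) p.1)
  filter_upwards [dπ₁_constField v, h0] with q h1 h2
  rw [mem_dist₂, h1, mem_dist₂.1 hv]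
  exact h2

theorem warped_dist₁_dist₂ (f : N₁ → ℝ) {p : N₁ × N₂} {v w : TProd E₁ E₂ p}
    (hv : v ∈ dist₁ E₁ E₂ p) (hw : w ∈ dist₂ E₁ E₂ p) : warped E₁ E₂ f p v w = 0 := by
  rw [warped, mem_dist₁.1 hv, mem_dist₂.1 hw, inner_zero_left, inner_zero_right]
  ring

theorem dπ₁_apply (p : N₁ × N₂) (a : E₁ × E₂) : dπ₁ (E₁ := E₁) (E₂ := E₂) p a = a.1 :=
  congrArg (fun A : E₁ × E₂ →L[ℝ] E₁ => A a) mfderiv_fst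

theorem dπ₂_apply (p : N₁ × N₂) (a : E₁ × E₂) : dπ₂ (E₁ := E₁) (E₂ := E₂) p a = a.2 :=
  congrArg (fun A : E₁ × E₂ →L[ℝ] E₂ => A a) mfderiv_snd

theorem exists_dist₁_dπ₁_eq {p : N₁ × N₂} (u : TProd E₁ E₂ p) :
    ∃ d ∈ dist₁ E₁ E₂ p, dπ₁ p d = dπ₁ p u :=
  ⟨(dπ₁ p u, 0), mem_dist₁.2 (dπ₂_apply (E₁ := E₁) p (dπ₁ p u, 0)),
    dπ₁_apply (E₁ := E₁) p (dπ₁ p u, 0)⟩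

theorem eq_zero_of_dπ {p : N₁ × N₂} {u : TProd E₁ E₂ p} (h₁ : dπ₁ p u = 0) (h₂ : dπ₂ p u = 0) :
    u = 0 :=
  Prod.ext ((dπ₁_apply p u).symm.trans h₁) ((dπ₂_apply p u).symm.trans h₂)

theorem eq_zero_of_warped_self {f : N₁ → ℝ} {p : N₁ × N₂} (hpos : 0 < f p.1)
    {u : TProd E₁ E₂ p} (h : warped E₁ E₂ f p u u = 0) : u = 0 := by
  rw [warped] at h
  have a1 : 0 ≤ ⟪dπ₁ p u, dπ₁ p u⟫_ℝ := real_inner_self_nonneg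
  have a2 : 0 ≤ ⟪dπ₂ p u, dπ₂ p u⟫_ℝ := real_inner_self_nonneg
  have a3 := mul_nonneg (pow_pos hpos 2).le a2
  refine eq_zero_of_dπ (inner_self_eq_zero (𝕜 := ℝ).1 (by linarith))
    (inner_self_eq_zero (𝕜 := ℝ).1 ?_)
  have h3 : f p.1 ^ 2 * ⟪dπ₂ p u, dπ₂ p u⟫_ℝ = 0 := by linarith
  exact (mul_eq_zero.1 h3).resolve_left (pow_pos hpos 2).ne'

end Distributions

/-! ### Tangential and normal parts of J -/

section Submanifold

set_option linter.unusedSectionVars false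

variable {E : Type*} [NormedAddCommGroup E] [NormedSpace ℂ E] [FiniteDimensional ℂ E]
  {M : Type*} [TopologicalSpace M] [ChartedSpace E M] [IsManifold 𝓘(ℝ, E) ∞ M]
  [RiemannianBundle (fun x : M => TangentSpace 𝓘(ℝ, E) x)]
  {E₁ : Type*} [NormedAddCommGroup E₁] [NormedSpace ℝ E₁]
  {N₁ : Type*} [TopologicalSpace N₁] [ChartedSpace E₁ N₁] [IsManifold 𝓘(ℝ, E₁) ∞ N₁]
  {E₂ : Type*} [NormedAddCommGroup E₂] [NormedSpace ℝ E₂]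
  {N₂ : Type*} [TopologicalSpace N₂] [ChartedSpace E₂ N₂] [IsManifold 𝓘(ℝ, E₂) ∞ N₂]

theorem inner_J_left {C : ComplexStructure E M} {α : Π x : M, TangentSpace 𝓘(ℝ, E) x →L[ℝ] ℝ}
    (hα : IsLCK C α) (x : M) (a b : TangentSpace 𝓘(ℝ, E) x) :
    ⟪C.J x a, b⟫_ℝ = -⟪a, C.J x b⟫_ℝ := by
  rw [← hα.hermitian x a (C.J x b), C.sq, inner_neg_right, neg_neg]

theorem dmap_tanJ (C : ComplexStructure E M) (φ : N₁ × N₂ → M) (p : N₁ × N₂)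
    (z : TProd E₁ E₂ p) : dmap E E₁ E₂ φ p (tanJ C φ p z)
      = (tanSpace E E₁ E₂ φ p).starProjection (C.J (φ p) (dmap E E₁ E₂ φ p z)) :=
  (exists_tangent φ p (C.J (φ p) (dmap E E₁ E₂ φ p z))).choose_spec

theorem normJ_eq_sub (C : ComplexStructure E M) (φ : N₁ × N₂ → M) (p : N₁ × N₂)
    (z : TProd E₁ E₂ p) : normJ C φ p z
      = C.J (φ p) (dmap E E₁ E₂ φ p z) - dmap E E₁ E₂ φ p (tanJ C φ p z) := by
  rw [dmap_tanJ, normJ, normalPart]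
  exact Submodule.starProjection_orthogonal_val _

theorem inner_normJ_of_mem (C : ComplexStructure E M) (φ : N₁ × N₂ → M) (p : N₁ × N₂)
    (z : TProd E₁ E₂ p) {a : TangentSpace 𝓘(ℝ, E) (φ p)} (ha : a ∈ tanSpace E E₁ E₂ φ p) :
    ⟪a, normJ C φ p z⟫_ℝ = 0 :=
  Submodule.inner_right_of_mem_orthogonal ha (Submodule.starProjection_apply_mem _ _)

theorem inner_dmap_tanJ (C : ComplexStructure E M) (φ : N₁ × N₂ → M) (p : N₁ × N₂)
    (z d : TProd E₁ E₂ p) : ⟪dmap E E₁ E₂ φ p d, dmap E E₁ E₂ φ p (tanJ C φ p z)⟫_ℝ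
      = ⟪dmap E E₁ E₂ φ p d, C.J (φ p) (dmap E E₁ E₂ φ p z)⟫_ℝ := by
  have h := inner_normJ_of_mem C φ p z (a := dmap E E₁ E₂ φ p d) ⟨d, rfl⟩
  rw [normJ_eq_sub, inner_sub_right] at h
  linarith

/-- Since Fz is normal, b may replace its normal part; then Fz = Jz - Pz separates the pairing with
Jz from a purely tangential pairing. -/
theorem inner_normalPart_normJ (C : ComplexStructure E M) (φ : N₁ × N₂ → M) (p : N₁ × N₂)
    (b : TangentSpace 𝓘(ℝ, E) (φ p)) (z : TProd E₁ E₂ p) :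
    ⟪normalPart E₁ E₂ φ p b, normJ C φ p z⟫_ℝ = ⟪b, C.J (φ p) (dmap E E₁ E₂ φ p z)⟫_ℝ
      - ⟪b, dmap E E₁ E₂ φ p (tanJ C φ p z)⟫_ℝ := by
  have h : normalPart E₁ E₂ φ p b = b - (tanSpace E E₁ E₂ φ p).starProjection b :=
    Submodule.starProjection_orthogonal_val _
  rw [h, inner_sub_left,
    inner_normJ_of_mem C φ p z (Submodule.starProjection_apply_mem _ _), normJ_eq_sub,
    inner_sub_right, sub_zero]

end Submanifold

/-! ### Semi-slant warped products: the Hessian on 𝔇 and 𝔇^θ, and the Lee form -/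

section SemiSlant

set_option linter.unusedSectionVars false

variable {E : Type*} [NormedAddCommGroup E] [NormedSpace ℂ E] [FiniteDimensional ℂ E]
  {M : Type*} [TopologicalSpace M] [ChartedSpace E M] [IsManifold 𝓘(ℝ, E) ∞ M]
  [RiemannianBundle (fun x : M => TangentSpace 𝓘(ℝ, E) x)]
  {E₁ : Type*} [NormedAddCommGroup E₁] [NormedSpace ℝ E₁]
  {N₁ : Type*} [TopologicalSpace N₁] [ChartedSpace E₁ N₁] [IsManifold 𝓘(ℝ, E₁) ∞ N₁]
  [RiemannianBundle (fun x : N₁ => TangentSpace 𝓘(ℝ, E₁) x)]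
  {E₂ : Type*} [NormedAddCommGroup E₂] [NormedSpace ℝ E₂]
  {N₂ : Type*} [TopologicalSpace N₂] [ChartedSpace E₂ N₂] [IsManifold 𝓘(ℝ, E₂) ∞ N₂]
  [RiemannianBundle (fun x : N₂ => TangentSpace 𝓘(ℝ, E₂) x)]
  {C : ComplexStructure E M} {α : Π x : M, TangentSpace 𝓘(ℝ, E) x →L[ℝ] ℝ}
  {nabla : (Π x : M, TangentSpace 𝓘(ℝ, E) x) →
    (Π x : M, TangentSpace 𝓘(ℝ, E) x →L[ℝ] TangentSpace 𝓘(ℝ, E) x)}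
  {φ : N₁ × N₂ → M} {f : N₁ → ℝ} {θ : N₁ × N₂ → ℝ} {p : N₁ × N₂}

namespace IsSemiSlantWarpedProduct

theorem dmap_injective (hφ : IsSemiSlantWarpedProduct (E₁ := E₁) (E₂ := E₂) C φ f θ)
    {u v : TProd E₁ E₂ p} (h : dmap E E₁ E₂ φ p u = dmap E E₁ E₂ φ p v) : u = v := by
  refine sub_eq_zero.1 (eq_zero_of_warped_self (hφ.pos_warping p.1) ?_)
  rw [← hφ.isometric, map_sub, h, sub_self, inner_zero_left]

theorem exists_dmap_eq_J (hφ : IsSemiSlantWarpedProduct (E₁ := E₁) (E₂ := E₂) C φ f θ)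
    {y : TProd E₁ E₂ p} (hy : y ∈ dist₁ E₁ E₂ p) :
    ∃ y' ∈ dist₁ E₁ E₂ p, dmap E E₁ E₂ φ p y' = C.J (φ p) (dmap E E₁ E₂ φ p y) := by
  have h : C.J (φ p) (dmap E E₁ E₂ φ p y)
      ∈ (dist₁ E₁ E₂ p).map (dmap E E₁ E₂ φ p).toLinearMap := by
    rw [← hφ.holomorphic p]
    exact ⟨_, ⟨y, hy, rfl⟩, rfl⟩
  obtain ⟨y', hy', h'⟩ := h
  exact ⟨y', hy', h'⟩

theorem dmap_tanJ_dist₁ (hφ : IsSemiSlantWarpedProduct (E₁ := E₁) (E₂ := E₂) C φ f θ)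
    {y : TProd E₁ E₂ p} (hy : y ∈ dist₁ E₁ E₂ p) :
    dmap E E₁ E₂ φ p (tanJ C φ p y) = C.J (φ p) (dmap E E₁ E₂ φ p y) := by
  obtain ⟨y', -, h⟩ := hφ.exists_dmap_eq_J hy
  rw [dmap_tanJ, ← h]
  exact Submodule.starProjection_eq_self_iff.2 ⟨y', rfl⟩

theorem tanJ_mem_dist₁ (hφ : IsSemiSlantWarpedProduct (E₁ := E₁) (E₂ := E₂) C φ f θ)
    {y : TProd E₁ E₂ p} (hy : y ∈ dist₁ E₁ E₂ p) : tanJ C φ p y ∈ dist₁ E₁ E₂ p := by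
  obtain ⟨y', hy', h⟩ := hφ.exists_dmap_eq_J hy
  rwa [hφ.dmap_injective ((hφ.dmap_tanJ_dist₁ hy).trans h.symm)]

/-- `𝔇` and `𝔇^θ` are orthogonal. -/
theorem inner_dmap (hφ : IsSemiSlantWarpedProduct (E₁ := E₁) (E₂ := E₂) C φ f θ)
    {y z : TProd E₁ E₂ p} (hy : y ∈ dist₁ E₁ E₂ p) (hz : z ∈ dist₂ E₁ E₂ p) :
    ⟪dmap E E₁ E₂ φ p y, dmap E E₁ E₂ φ p z⟫_ℝ = 0 := by
  rw [hφ.isometric, warped_dist₁_dist₂ f hy hz]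

theorem inner_J_dmap (hφ : IsSemiSlantWarpedProduct (E₁ := E₁) (E₂ := E₂) C φ f θ)
    {y z : TProd E₁ E₂ p} (hy : y ∈ dist₁ E₁ E₂ p) (hz : z ∈ dist₂ E₁ E₂ p) :
    ⟪C.J (φ p) (dmap E E₁ E₂ φ p y), dmap E E₁ E₂ φ p z⟫_ℝ = 0 := by
  rw [← hφ.dmap_tanJ_dist₁ hy]
  exact hφ.inner_dmap (hφ.tanJ_mem_dist₁ hy) hz

/-- For d in 𝔇, g(d,Pz) = g(d,Jz) = -g(Jd,z) = 0 because 𝔇 is holomorphic and orthogonal to z.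
Choosing d to be the 𝔇-part of Pz makes that part orthogonal to itself. -/
theorem tanJ_mem_dist₂ (hφ : IsSemiSlantWarpedProduct (E₁ := E₁) (E₂ := E₂) C φ f θ)
    (hα : IsLCK C α) {z : TProd E₁ E₂ p} (hz : z ∈ dist₂ E₁ E₂ p) :
    tanJ C φ p z ∈ dist₂ E₁ E₂ p := by
  obtain ⟨d, hd, h⟩ := exists_dist₁_dπ₁_eq (tanJ C φ p z)
  have h0 := inner_dmap_tanJ C φ p z d
  have h1 : ⟪dmap E E₁ E₂ φ p d, C.J (φ p) (dmap E E₁ E₂ φ p z)⟫_ℝ = 0 := by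
    rw [← neg_eq_zero, ← inner_J_left hα, hφ.inner_J_dmap hd hz]
  rw [h1, hφ.isometric, warped, h, mem_dist₁.1 hd, inner_zero_left, mul_zero, add_zero] at h0
  exact mem_dist₂.2 (inner_self_eq_zero.1 h0)

variable [IsContMDiffRiemannianBundle 𝓘(ℝ, E) ∞ E (fun x : M => TangentSpace 𝓘(ℝ, E) x)]

/-- The Hessian of `φ` differentiates the coefficients of the induced metric. -/
theorem mvfderiv_warped_eq (hφ : IsSemiSlantWarpedProduct (E₁ := E₁) (E₂ := E₂) C φ f θ)
    (hn : IsLeviCivitaOn (metric E M) Set.univ nabla) (u v w : TProd E₁ E₂ p) :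
    mvfderiv (prodModel E₁ E₂)
        (fun q => warped E₁ E₂ f q (constField v q) (constField w q)) p u
      = ⟪hessian nabla φ p u v, dmap E E₁ E₂ φ p w⟫_ℝ
        + ⟪dmap E E₁ E₂ φ p v, hessian nabla φ p u w⟫_ℝ := by
  have h := mvfderiv_inner_along hn ((hφ.smooth p).mdifferentiableAt (by simp))
    (diffAlong_dmap hφ.smooth (mdifferentiableAt_constField v))
    (diffAlong_dmap hφ.smooth (mdifferentiableAt_constField w)) u
  simp only [hφ.isometric, FiberBundle.extend_apply_self] at h
  exact h

/-- The Koszul formula. -/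
theorem koszul (hφ : IsSemiSlantWarpedProduct (E₁ := E₁) (E₂ := E₂) C φ f θ)
    (hn : IsLeviCivitaOn (metric E M) Set.univ nabla) (u v w : TProd E₁ E₂ p) :
    2 * ⟪hessian nabla φ p u v, dmap E E₁ E₂ φ p w⟫_ℝ
      = mvfderiv (prodModel E₁ E₂)
          (fun q => warped E₁ E₂ f q (constField v q) (constField w q)) p u
        + mvfderiv (prodModel E₁ E₂)
          (fun q => warped E₁ E₂ f q (constField u q) (constField w q)) p v
        - mvfderiv (prodModel E₁ E₂)
          (fun q => warped E₁ E₂ f q (constField v q) (constField u q)) p w := by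
  -- Each derivative is a sum of two Hessian terms; by symmetry of the Hessian all but the two equal
  -- ones cancel.
  rw [hφ.mvfderiv_warped_eq hn, hφ.mvfderiv_warped_eq hn, hφ.mvfderiv_warped_eq hn,
    hessian_symm hn hφ.smooth p v u, hessian_symm hn hφ.smooth p w u,
    hessian_symm hn hφ.smooth p w v, real_inner_comm (dmap E E₁ E₂ φ p u)]
  ring

/-- For `y ∈ 𝔇` and `z ∈ 𝔇^θ` the relation `g(J y, z) = 0` is differentiated. -/
theorem inner_hessian_J (hφ : IsSemiSlantWarpedProduct (E₁ := E₁) (E₂ := E₂) C φ f θ)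
    (hα : IsLCK C α) (hn : IsLeviCivitaOn (metric E M) Set.univ nabla)
    (u : TProd E₁ E₂ p) {y z : TProd E₁ E₂ p}
    (hy : y ∈ dist₁ E₁ E₂ p) (hz : z ∈ dist₂ E₁ E₂ p) :
    ⟪hessian nabla φ p u y, C.J (φ p) (dmap E E₁ E₂ φ p z)⟫_ℝ
      = ⟪C.J (φ p) (dmap E E₁ E₂ φ p y), hessian nabla φ p u z⟫_ℝ
        + α (φ p) (C.J (φ p) (dmap E E₁ E₂ φ p y))
          * ⟪dmap E E₁ E₂ φ p u, dmap E E₁ E₂ φ p z⟫_ℝ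
        - ⟪dmap E E₁ E₂ φ p u, C.J (φ p) (dmap E E₁ E₂ φ p y)⟫_ℝ
          * α (φ p) (dmap E E₁ E₂ φ p z)
        - α (φ p) (dmap E E₁ E₂ φ p y)
          * ⟪C.J (φ p) (dmap E E₁ E₂ φ p u), dmap E E₁ E₂ φ p z⟫_ℝ
        + ⟪dmap E E₁ E₂ φ p u, dmap E E₁ E₂ φ p y⟫_ℝ
          * ⟪C.J (φ p) (leeVector α (φ p)), dmap E E₁ E₂ φ p z⟫_ℝ := by
  have hd : MDifferentiableAt (prodModel E₁ E₂) 𝓘(ℝ, E) φ p :=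
    (hφ.smooth p).mdifferentiableAt (by simp)
  have hY := diffAlong_dmap hφ.smooth (mdifferentiableAt_constField y)
  have hZ := diffAlong_dmap hφ.smooth (mdifferentiableAt_constField z)
  have h := mvfderiv_inner_along hn hd (hY.J C hd) hZ u
  have h0 : (fun q => ⟪C.J (φ q) (dmap E E₁ E₂ φ q (constField y q)),
      dmap E E₁ E₂ φ q (constField z q)⟫_ℝ) =ᶠ[nhds p] fun _ => (0 : ℝ) := by
    filter_upwards [constField_mem_dist₁ hy, constField_mem_dist₂ hz] with q h1 h2
    exact hφ.inner_J_dmap h1 h2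
  have h1 : mvfderiv (prodModel E₁ E₂) (fun _ : N₁ × N₂ => (0 : ℝ)) p u = 0 := by
    rw [mvfderiv_const]
    rfl
  rw [mvfderiv_congr h0, h1, covDerivAlong_J hα hn hd hY] at h
  simp only [FiberBundle.extend_apply_self, inner_add_left, inner_sub_left,
    real_inner_smul_left, inner_leeVector] at h
  have h2 := inner_J_left hα (φ p) (hessian nabla φ p u y) (dmap E E₁ E₂ φ p z)
  rw [hessian] at h2 ⊢
  rw [hessian]
  linarith

variable [IsContMDiffRiemannianBundle 𝓘(ℝ, E₁) ∞ E₁ (fun x : N₁ => TangentSpace 𝓘(ℝ, E₁) x)]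
  [IsContMDiffRiemannianBundle 𝓘(ℝ, E₂) ∞ E₂ (fun x : N₂ => TangentSpace 𝓘(ℝ, E₂) x)]

theorem mdifferentiableAt_warping
    (hφ : IsSemiSlantWarpedProduct (E₁ := E₁) (E₂ := E₂) C φ f θ) (x : N₁) :
    MDifferentiableAt 𝓘(ℝ, E₁) 𝓘(ℝ, ℝ) f x :=
  (hφ.smooth_warping x).mdifferentiableAt (by simp)

/-- The first factor is totally geodesic in the warped product. -/
theorem inner_hessian_dist₁_dist₁
    (hφ : IsSemiSlantWarpedProduct (E₁ := E₁) (E₂ := E₂) C φ f θ)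
    (hn : IsLeviCivitaOn (metric E M) Set.univ nabla) {u v w : TProd E₁ E₂ p}
    (hu : u ∈ dist₁ E₁ E₂ p) (hv : v ∈ dist₁ E₁ E₂ p) (hw : w ∈ dist₂ E₁ E₂ p) :
    ⟪hessian nabla φ p u v, dmap E E₁ E₂ φ p w⟫_ℝ = 0 := by
  have h := hφ.koszul hn u v w
  have hf := hφ.mdifferentiableAt_warping p.1
  rw [mvfderiv_warped_dist₁_dist₂ hf _ hv hw, mvfderiv_warped_dist₁_dist₂ hf _ hu hw,
    mvfderiv_warped_dist₁_dist₁ hf hw hv] at h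
  linarith

/-- Obtained from `inner_hessian_dist₁_dist₁` by differentiating g(v,w) = 0 along u. -/
theorem inner_dist₁_hessian_dist₁
    (hφ : IsSemiSlantWarpedProduct (E₁ := E₁) (E₂ := E₂) C φ f θ)
    (hn : IsLeviCivitaOn (metric E M) Set.univ nabla) {u v w : TProd E₁ E₂ p}
    (hu : u ∈ dist₁ E₁ E₂ p) (hv : v ∈ dist₁ E₁ E₂ p) (hw : w ∈ dist₂ E₁ E₂ p) :
    ⟪dmap E E₁ E₂ φ p v, hessian nabla φ p u w⟫_ℝ = 0 := by
  have h := hφ.mvfderiv_warped_eq hn u v w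
  rw [mvfderiv_warped_dist₁_dist₂ (hφ.mdifferentiableAt_warping p.1) _ hv hw,
    hφ.inner_hessian_dist₁_dist₁ hn hu hv hw] at h
  linarith

/-- `∇_u v` has `𝔇^θ`-component `v(ln f) u`, for `v ∈ 𝔇` and `u ∈ 𝔇^θ`. -/
theorem inner_hessian_dist₂_dist₁
    (hφ : IsSemiSlantWarpedProduct (E₁ := E₁) (E₂ := E₂) C φ f θ)
    (hn : IsLeviCivitaOn (metric E M) Set.univ nabla) {u v w : TProd E₁ E₂ p}
    (hu : u ∈ dist₂ E₁ E₂ p) (hv : v ∈ dist₁ E₁ E₂ p) (hw : w ∈ dist₂ E₁ E₂ p) :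
    ⟪hessian nabla φ p u v, dmap E E₁ E₂ φ p w⟫_ℝ
      = derivLog f p v * warped E₁ E₂ f p u w := by
  have h := hφ.koszul hn u v w
  have hf := hφ.mdifferentiableAt_warping p.1
  rw [mvfderiv_warped_dist₁_dist₂ hf _ hv hw, mvfderiv_warped_dist₁_dist₂ hf _ hv hu,
    mvfderiv_warped_dist₂_dist₂ hf (hφ.pos_warping p.1) hv hu] at h
  linarith

theorem inner_dist₁_hessian_dist₂
    (hφ : IsSemiSlantWarpedProduct (E₁ := E₁) (E₂ := E₂) C φ f θ)
    (hn : IsLeviCivitaOn (metric E M) Set.univ nabla) {u v w : TProd E₁ E₂ p}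
    (hu : u ∈ dist₂ E₁ E₂ p) (hv : v ∈ dist₁ E₁ E₂ p) (hw : w ∈ dist₂ E₁ E₂ p) :
    ⟪dmap E E₁ E₂ φ p v, hessian nabla φ p u w⟫_ℝ
      = -(derivLog f p v * warped E₁ E₂ f p u w) := by
  have h := hφ.mvfderiv_warped_eq hn u v w
  rw [mvfderiv_warped_dist₁_dist₂ (hφ.mdifferentiableAt_warping p.1) _ hv hw,
    hφ.inner_hessian_dist₂_dist₁ hn hu hv hw] at h
  linarith

/-- The second fundamental form on `𝔇 × 𝔇`, before the Lee form is known to vanish on `𝔇^θ`. -/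
theorem inner_hessian_J_dist₁
    (hφ : IsSemiSlantWarpedProduct (E₁ := E₁) (E₂ := E₂) C φ f θ)
    (hα : IsLCK C α) (hn : IsLeviCivitaOn (metric E M) Set.univ nabla) {x y z : TProd E₁ E₂ p}
    (hx : x ∈ dist₁ E₁ E₂ p) (hy : y ∈ dist₁ E₁ E₂ p) (hz : z ∈ dist₂ E₁ E₂ p) :
    ⟪hessian nabla φ p x y, C.J (φ p) (dmap E E₁ E₂ φ p z)⟫_ℝ
      = -(⟪dmap E E₁ E₂ φ p x, C.J (φ p) (dmap E E₁ E₂ φ p y)⟫_ℝ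
          * α (φ p) (dmap E E₁ E₂ φ p z))
        + ⟪dmap E E₁ E₂ φ p x, dmap E E₁ E₂ φ p y⟫_ℝ
          * ⟪C.J (φ p) (leeVector α (φ p)), dmap E E₁ E₂ φ p z⟫_ℝ := by
  rw [hφ.inner_hessian_J hα hn x hy hz, ← hφ.dmap_tanJ_dist₁ hy, ← hφ.dmap_tanJ_dist₁ hx,
    hφ.inner_dist₁_hessian_dist₁ hn hx (hφ.tanJ_mem_dist₁ hy) hz, hφ.inner_dmap hx hz,
    hφ.inner_dmap (hφ.tanJ_mem_dist₁ hx) hz]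
  ring

/-- Unless `𝔇 = 0`, the Lee form vanishes on `𝔇^θ`. -/
theorem leeForm_dist₂
    (hφ : IsSemiSlantWarpedProduct (E₁ := E₁) (E₂ := E₂) C φ f θ)
    (hα : IsLCK C α) (hn : IsLeviCivitaOn (metric E M) Set.univ nabla) {y z : TProd E₁ E₂ p}
    (hy : y ∈ dist₁ E₁ E₂ p) (hy0 : y ≠ 0) (hz : z ∈ dist₂ E₁ E₂ p) :
    α (φ p) (dmap E E₁ E₂ φ p z) = 0 := by
  -- The vector Jy lies in 𝔇. In the pairs (Jy,y) and (y,Jy) the terms with Jλ agree, while those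
  -- with α(z) are -|y|²α(z) and |y|²α(z).
  have hy' := hφ.tanJ_mem_dist₁ hy
  have h1 := hφ.inner_hessian_J_dist₁ hα hn hy' hy hz
  have h2 := hφ.inner_hessian_J_dist₁ hα hn hy hy' hz
  rw [hessian_symm hn hφ.smooth, h2, hφ.dmap_tanJ_dist₁ hy, C.sq, inner_neg_right,
    hα.hermitian, real_inner_comm (dmap E E₁ E₂ φ p y) (C.J (φ p) _)] at h1
  have h3 : ⟪dmap E E₁ E₂ φ p y, dmap E E₁ E₂ φ p y⟫_ℝ ≠ 0 := by
    intro h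
    rw [hφ.isometric] at h
    exact hy0 (eq_zero_of_warped_self (hφ.pos_warping p.1) h)
  exact (mul_eq_zero.1 (by linarith : ⟪dmap E E₁ E₂ φ p y, dmap E E₁ E₂ φ p y⟫_ℝ
    * α (φ p) (dmap E E₁ E₂ φ p z) = 0)).resolve_left h3

theorem inner_normalPart_hessian_dist₁_dist₁
    (hφ : IsSemiSlantWarpedProduct (E₁ := E₁) (E₂ := E₂) C φ f θ)
    (hα : IsLCK C α) (hn : IsLeviCivitaOn (metric E M) Set.univ nabla)
    (hlee : leeVector α (φ p) ∈ tanSpace E E₁ E₂ φ p) {x y z : TProd E₁ E₂ p}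
    (hx : x ∈ dist₁ E₁ E₂ p) (hy : y ∈ dist₁ E₁ E₂ p) (hz : z ∈ dist₂ E₁ E₂ p) :
    ⟪normalPart E₁ E₂ φ p (hessian nabla φ p x y), normJ C φ p z⟫_ℝ = 0 := by
  rw [inner_normalPart_normJ, hφ.inner_hessian_dist₁_dist₁ hn hx hy (hφ.tanJ_mem_dist₂ hα hz),
    hφ.inner_hessian_J_dist₁ hα hn hx hy hz]
  -- If y = 0 both Lee terms vanish trivially; otherwise y witnesses 𝔇 ≠ 0 at p, as `leeForm_dist₂`
  -- requires.
  by_cases h0 : y = 0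
  · rw [h0, map_zero, map_zero, inner_zero_right]
    ring
  -- Tangency of λ gives g(λ,Fz) = 0, so g(λ,Jz) = α(Pz), and Pz lies in 𝔇^θ, where α vanishes.
  have h1 := inner_normJ_of_mem C φ p z hlee
  rw [normJ_eq_sub, inner_sub_right, inner_leeVector α _ (dmap E E₁ E₂ φ p (tanJ C φ p z)),
    hφ.leeForm_dist₂ hα hn hy h0 (hφ.tanJ_mem_dist₂ hα hz)] at h1
  rw [hφ.leeForm_dist₂ hα hn hy h0 hz, inner_J_left hα]
  have h2 : ⟪leeVector α (φ p), C.J (φ p) (dmap E E₁ E₂ φ p z)⟫_ℝ = 0 := by linarith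
  rw [h2]
  ring

theorem inner_normalPart_hessian_dist₁_dist₂
    (hφ : IsSemiSlantWarpedProduct (E₁ := E₁) (E₂ := E₂) C φ f θ)
    (hα : IsLCK C α) (hn : IsLeviCivitaOn (metric E M) Set.univ nabla)
    {x z w : TProd E₁ E₂ p}
    (hx : x ∈ dist₁ E₁ E₂ p) (hz : z ∈ dist₂ E₁ E₂ p) (hw : w ∈ dist₂ E₁ E₂ p) :
    ⟪normalPart E₁ E₂ φ p (hessian nabla φ p x z), normJ C φ p w⟫_ℝ
      = (⟪leeVector α (φ p), C.J (φ p) (dmap E E₁ E₂ φ p x)⟫_ℝ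
          - derivLog f p (tanJ C φ p x)) * warped E₁ E₂ f p z w
        + (⟪leeVector α (φ p), dmap E E₁ E₂ φ p x⟫_ℝ - derivLog f p x)
          * warped E₁ E₂ f p z (tanJ C φ p w) := by
  have hx' := hφ.tanJ_mem_dist₁ hx
  have h1 : ⟪C.J (φ p) (dmap E E₁ E₂ φ p z), dmap E E₁ E₂ φ p w⟫_ℝ
      = -warped E₁ E₂ f p z (tanJ C φ p w) := by
    rw [inner_J_left hα, ← inner_dmap_tanJ, hφ.isometric]
  have h2 : ⟪dmap E E₁ E₂ φ p z, dmap E E₁ E₂ φ p x⟫_ℝ = 0 := by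
    rw [real_inner_comm, hφ.inner_dmap hx hz]
  have h3 : ⟪dmap E E₁ E₂ φ p z, dmap E E₁ E₂ φ p (tanJ C φ p x)⟫_ℝ = 0 := by
    rw [real_inner_comm, hφ.inner_dmap hx' hz]
  -- The Hessian is flipped so that the 𝔇-vector x is the one differentiated, in the direction z.
  -- The Jw pairing then yields the Lee terms and -Jx(ln f) g(z,w), and the Pw pairing yields x(ln
  -- f) g(z,Pw).
  rw [inner_normalPart_normJ, hessian_symm hn hφ.smooth p x z,
    hφ.inner_hessian_dist₂_dist₁ hn hz hx (hφ.tanJ_mem_dist₂ hα hw),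
    hφ.inner_hessian_J hα hn z hx hw, h1, h2, ← hφ.dmap_tanJ_dist₁ hx, h3,
    hφ.inner_dist₁_hessian_dist₂ hn hz hx' hw, hφ.isometric, inner_leeVector, inner_leeVector]
  ring

end IsSemiSlantWarpedProduct

end SemiSlant

end LCK

end

theorem lemma4p2
    -- the ambient complex manifold `M` with its Riemannian metric
    {E : Type*} [NormedAddCommGroup E] [NormedSpace ℂ E] [FiniteDimensional ℂ E]
    {M : Type*} [TopologicalSpace M] [ChartedSpace E M] [IsManifold 𝓘(ℝ, E) ∞ M]
    [RiemannianBundle (fun x : M => TangentSpace 𝓘(ℝ, E) x)]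
    [IsContMDiffRiemannianBundle 𝓘(ℝ, E) ∞ E (fun x : M => TangentSpace 𝓘(ℝ, E) x)]
    -- the Riemannian manifolds `N^T` and `N^θ`
    {E₁ : Type*} [NormedAddCommGroup E₁] [NormedSpace ℝ E₁] [FiniteDimensional ℝ E₁]
    {N₁ : Type*} [TopologicalSpace N₁] [ChartedSpace E₁ N₁] [IsManifold 𝓘(ℝ, E₁) ∞ N₁]
    [RiemannianBundle (fun x : N₁ => TangentSpace 𝓘(ℝ, E₁) x)]
    [IsContMDiffRiemannianBundle 𝓘(ℝ, E₁) ∞ E₁ (fun x : N₁ => TangentSpace 𝓘(ℝ, E₁) x)]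
    {E₂ : Type*} [NormedAddCommGroup E₂] [NormedSpace ℝ E₂] [FiniteDimensional ℝ E₂]
    {N₂ : Type*} [TopologicalSpace N₂] [ChartedSpace E₂ N₂] [IsManifold 𝓘(ℝ, E₂) ∞ N₂]
    [RiemannianBundle (fun x : N₂ => TangentSpace 𝓘(ℝ, E₂) x)]
    [IsContMDiffRiemannianBundle 𝓘(ℝ, E₂) ∞ E₂ (fun x : N₂ => TangentSpace 𝓘(ℝ, E₂) x)]
    -- the LCK structure, its Lee form and the Levi-Civita connection of the ambient metric
    (C : ComplexStructure E M) (α : Π x : M, TangentSpace 𝓘(ℝ, E) x →L[ℝ] ℝ) (hα : IsLCK C α)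
    (nabla : CovariantDerivative 𝓘(ℝ, E) E (TangentSpace 𝓘(ℝ, E) : M → Type _))
    (hnabla : IsLeviCivitaOn (metric E M) Set.univ nabla)
    -- the warped product submanifold, to which the Lee vector field is tangent
    (φ : N₁ × N₂ → M) (f : N₁ → ℝ) (θ : N₁ × N₂ → ℝ)
    (hφ : IsSemiSlantWarpedProduct (E₁ := E₁) (E₂ := E₂) C φ f θ)
    (hlee : ∀ p : N₁ × N₂, leeVector α (φ p) ∈ tanSpace E E₁ E₂ φ p)
    -- sections `X, Y` of `𝔇` and `Z, W` of `𝔇^θ`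
    (X Y Z W : Π p : N₁ × N₂, TProd E₁ E₂ p)
    (hX : SmoothField X)
    (hY : SmoothField Y)
    (hZ : SmoothField Z)
    (hW : SmoothField W)
    (hXD : ∀ p, X p ∈ dist₁ E₁ E₂ p) (hYD : ∀ p, Y p ∈ dist₁ E₁ E₂ p)
    (hZD : ∀ p, Z p ∈ dist₂ E₁ E₂ p) (hWD : ∀ p, W p ∈ dist₂ E₁ E₂ p)
    (p : N₁ × N₂) :
    ⟪secondFF nabla φ X Y p, normJ C φ p (Z p)⟫_ℝ = 0 ∧
    ⟪secondFF nabla φ X Z p, normJ C φ p (W p)⟫_ℝ =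
      (⟪leeVector α (φ p), C.J (φ p) (dmap E E₁ E₂ φ p (X p))⟫_ℝ
          - derivLog f p (tanJ C φ p (X p))) * warped E₁ E₂ f p (Z p) (W p)
      + (⟪leeVector α (φ p), dmap E E₁ E₂ φ p (X p)⟫_ℝ - derivLog f p (X p))
          * warped E₁ E₂ f p (Z p) (tanJ C φ p (W p)) := by
  have hd := hφ.smooth
  rw [secondFF_eq_hessian nabla hd X hY p, secondFF_eq_hessian nabla hd X hZ p]
  exact ⟨hφ.inner_normalPart_hessian_dist₁_dist₁ hα hnabla (hlee p) (hXD p) (hYD p) (hZD p),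
    hφ.inner_normalPart_hessian_dist₁_dist₂ hα hnabla (hXD p) (hZD p) (hWD p)⟩
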